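/- Let $K$ be a number field with algebraic closure $\bar K$ and absolute Galois group $G_K$, and let $T$ be an algebraic torus over $K$ with character group $\hat T=\mathrm{Hom}_{\bar K}(T_{\bar K},\mathbb{G}_{m,\bar K})$, regarded as a discrete $G_K$-module and as the corresponding étale sheaf on $\mathrm{Spec}(K)$. Let $S$ be a finite set of places of $K$ containing all archimedean places, let $O_{K,S}$ be the ring of $S$-integers of $K$, let $U=\mathrm{Spec}(O_{K,S})$, and let $j:\mathrm{Spec}(K)\to U$ be the inclusion of the generic point. For a place $v$ of $K$ put $T_v^c=\{x\in T(K_v): |\chi(x)|_v=1 \text{ for every character } \chi \text{ of } T \text{ defined over } K_v\}$, and define the group of $S$-units of $T$ by $$T(O_{K,S})=\{x\in T(K): x\in T_v^c \text{ for all } v\notin S\}.$$ Then there is a canonical isomorphism of abelian groups $$T(O_{K,S})\;\simeq\;\mathrm{Hom}_U(j_*\hat T,\mathbb{G}_m),$$ where $\mathrm{Hom}_U$ denotes the group of homomorphisms of sheaves of abelian groups on the small étale site of $U$. Explicitly, the isomorphism sends $x\in T(O_{K,S})$ to the homomorphism that maps a section $\chi\in (j_*\hat T)(V)=\hat T(V\times_U\mathrm{Spec}(K))$,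 for $V$ étale over $U$, to the unit $\chi(x)\in\mathbb{G}_m(V)$, i.e. to the unit on $V$ whose value at every $\bar K$-point $p$ of $V\times_U \mathrm{Spec}(K)$ is $\chi_p(x)\in\bar K^\times$, where $\chi_p\in\hat T$ denotes the value of $\chi$ at $p$. -/

import Mathlib

open CategoryTheory Opposite AlgebraicGeometry TensorProduct NumberField IsDedekindDomain

universe u

noncomputable section

namespace EtaleTori

/-- The group `T(L)` of `L`-valued points of the affine `K`-group scheme `T = Spec A`: the
`K`-algebra homomorphisms `A → L`, with the (convolution) product induced by the comultiplication
of `A`. -/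
def Points (K A L : Type u) [Field K] [CommRing A] [HopfAlgebra K A] [Field L] [Algebra K L] :
    Type u :=
  WithConv (A →ₐ[K] L)

section Points

variable {K A L : Type u} [Field K] [CommRing A] [HopfAlgebra K A] [Field L] [Algebra K L]

/-- The `K`-algebra homomorphism `A → L` underlying a point. -/
def Points.hom (x : Points K A L) : A →ₐ[K] L := WithConv.ofConv x

instance : Monoid (Points K A L) := inferInstanceAs (Monoid (WithConv (A →ₐ[K] L)))

instance : Inv (Points K A L) where
  inv x := WithConv.toConv (x.hom.comp (HopfAlgebra.antipodeAlgHom K A))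

instance : Group (Points K A L) where
  inv_mul_cancel x := by
    have h := congrArg (fun f : WithConv (A →ₐ[K] A) => x.hom.comp f.ofConv)
      (AlgHom.antipode_id_cancel (R := K) (A := A))
    have h2 := (AlgHom.comp_convMul_distrib x.hom
      (WithConv.toConv (HopfAlgebra.antipodeAlgHom K A)) (WithConv.toConv (AlgHom.id K A)))
    refine WithConv.ext ?_
    refine (Eq.trans ?_ h2.symm).trans (h.trans ?_)
    · rfl
    · ext a
      rw [AlgHom.comp_apply, AlgHom.convOne_apply]
      exact x.hom.commutes _

/-- The group homomorphism `T(L) → T(M)` induced by a homomorphism `L → M` of extensions of `K`. -/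
def Points.map {M : Type u} [Field M] [Algebra K M] (φ : L →ₐ[K] M) :
    Points K A L →* Points K A M where
  toFun x := WithConv.toConv (φ.comp x.hom)
  map_one' := by
    refine WithConv.ext ?_
    ext a
    exact φ.commutes _
  map_mul' x y := WithConv.ext (AlgHom.comp_convMul_distrib φ _ _)

/-- The group `Hom_L(T_L, 𝔾ₘ)` of characters of `T` defined over `L`, that is, the group-like
elements of the coordinate Hopf algebra `L ⊗[K] A` of the base change `T_L`. -/
abbrev Characters (K A L : Type u) [Field K] [CommRing A] [HopfAlgebra K A] [Field L]
    [Algebra K L] : Type u :=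
  GroupLike L (L ⊗[K] A)

/-- The `L`-algebra homomorphism `L ⊗[K] A → L` attached to a point `x ∈ T(L) = T_L(L)`. -/
def Points.baseChange (x : Points K A L) : L ⊗[K] A →ₐ[L] L :=
  Algebra.TensorProduct.lift (AlgHom.id L L) x.hom fun _ _ => Commute.all _ _

/-- The value `χ(x) ∈ L` of a character `χ` over `L` at a point `x ∈ T(L)`. -/
def Characters.eval (χ : Characters K A L) (x : Points K A L) : L := x.baseChange χ.val

lemma Characters.eval_one (χ : Characters K A L) : χ.eval 1 = 1 := by
  have h : (Points.baseChange (1 : Points K A L)) = Bialgebra.counitAlgHom L (L ⊗[K] A) := by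
    ext a
    simp [Points.baseChange]
    exact AlgHom.convOne_apply a
  rw [Characters.eval, h]
  exact χ.2.counit_eq_one

lemma Characters.eval_mul (χ : Characters K A L) (x y : Points K A L) :
    χ.eval (x * y) = χ.eval x * χ.eval y := by
  have h : ∀ w : A ⊗[K] A,
      (Algebra.TensorProduct.lift x.baseChange y.baseChange fun _ _ => Commute.all _ _ :
        (L ⊗[K] A) ⊗[L] (L ⊗[K] A) →ₐ[L] L)
        (TensorProduct.AlgebraTensorModule.tensorTensorTensorComm K L K L L L A A
          (((1 : L) ⊗ₜ[L] (1 : L)) ⊗ₜ[K] w)) =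
      (Algebra.TensorProduct.lift x.hom y.hom fun _ _ => Commute.all _ _ : A ⊗[K] A →ₐ[K] L) w := by
    intro w
    induction w with
    | zero => simp
    | add a b ha hb => rw [TensorProduct.tmul_add, map_add, map_add, ha, hb, map_add]
    | tmul a b => simp [Points.baseChange]
  have h2 : (x * y).baseChange = (Algebra.TensorProduct.lift x.baseChange y.baseChange
      fun _ _ => Commute.all _ _).comp (Bialgebra.comulAlgHom L (L ⊗[K] A)) := by
    ext a
    have := h (Coalgebra.comul a)
    simp only [Points.baseChange] at this ⊢
    simp [TensorProduct.comul_tmul]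
    rw [this]
    exact AlgHom.convMul_apply (x : WithConv (A →ₐ[K] L)) y a
  rw [Characters.eval, h2]
  simp [χ.2.comul_eq_tmul_self, Characters.eval]

/-- The action `σ ⊗ id` of an automorphism `σ` of `L/K` on `L ⊗[K] A`. -/
def conj (A : Type u) [CommRing A] [HopfAlgebra K A] (σ : Gal(L/K)) : L ⊗[K] A →ₐ[K] L ⊗[K] A :=
  Algebra.TensorProduct.map (σ : L →ₐ[K] L) (AlgHom.id K A)

/-- `conj` as a `σ`-semilinear map. -/
def conjₛₗ (A : Type u) [CommRing A] [HopfAlgebra K A] (σ : Gal(L/K)) :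
    L ⊗[K] A →ₛₗ[(σ : L →+* L)] L ⊗[K] A where
  toFun := conj A σ
  map_add' := map_add _
  map_smul' l z := by
    rw [Algebra.smul_def, map_mul, Algebra.smul_def]
    rfl

lemma isGroupLikeElem_conj (σ : Gal(L/K)) {z : L ⊗[K] A} (hz : IsGroupLikeElem L z) :
    IsGroupLikeElem L (conj A σ z) := by
  constructor
  · have : ∀ z : L ⊗[K] A, Coalgebra.counit (R := L) (conj A σ z) = σ (Coalgebra.counit (R := L) z) := by
      intro z
      induction z with
      | zero => simp
      | add a b ha hb => simp only [map_add, ha, hb]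
      | tmul a b => simp [conj, Algebra.smul_def]
    rw [this, hz.counit_eq_one, map_one]
  · have h1 : ∀ l (w : A ⊗[K] A), TensorProduct.AlgebraTensorModule.tensorTensorTensorComm K L K L L L A A
          ((((1 : L) ⊗ₜ[L] σ l)) ⊗ₜ[K] w) = TensorProduct.map (conjₛₗ A σ) (conjₛₗ A σ)
          (TensorProduct.AlgebraTensorModule.tensorTensorTensorComm K L K L L L A A
          (((1 : L) ⊗ₜ[L] l) ⊗ₜ[K] w)) := by
      intro l w
      induction w with
      | zero => simp
      | add a b ha hb => simp only [TensorProduct.tmul_add, map_add, ha, hb]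
      | tmul a b => simp [conjₛₗ, conj]
    have h2 : ∀ z : L ⊗[K] A, Coalgebra.comul (R := L) (conj A σ z) =
        TensorProduct.map (conjₛₗ A σ) (conjₛₗ A σ) (Coalgebra.comul (R := L) z) := by
      intro z
      induction z with
      | zero => rw [map_zero, LinearMap.map_zero, LinearMap.map_zero]
      | add a b ha hb =>
        rw [map_add (conj A σ), LinearMap.map_add, ha, hb, LinearMap.map_add, LinearMap.map_add]
      | tmul a b =>
        have e1 : conj A σ (a ⊗ₜ[K] b) = σ a ⊗ₜ[K] b := rfl
        have e2 := TensorProduct.comul_tmul (R := K) (S := L) (σ a) b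
        have e3 := TensorProduct.comul_tmul (R := K) (S := L) a b
        refine ((congrArg _ e1).trans e2).trans (Eq.trans ?_ (congrArg _ e3.symm))
        rw [CommSemiring.comul_apply, CommSemiring.comul_apply]
        exact h1 a _
    rw [h2, hz.comul_eq_tmul_self, TensorProduct.map_tmul]
    rfl

/-- The action of `Gal(L/K)` on the characters of `T` over `L`, `χ ↦ (σ ⊗ id)(χ)`. -/
instance : MulDistribMulAction Gal(L/K) (Characters K A L) where
  smul σ χ := ⟨conj A σ χ.val, isGroupLikeElem_conj σ χ.2⟩
  one_smul χ := GroupLike.ext (by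
    change conj A 1 χ.val = χ.val
    have : conj (L := L) (K := K) A 1 = AlgHom.id K _ := by ext <;> simp [conj]
    rw [this]; rfl)
  mul_smul σ τ χ := GroupLike.ext (by
    change conj A (σ * τ) χ.val = conj A σ (conj A τ χ.val)
    have : conj (L := L) (K := K) A (σ * τ) = (conj A σ).comp (conj A τ) := by ext <;> simp [conj]
    rw [this]; rfl)
  smul_mul σ χ ψ := GroupLike.ext (map_mul (conj A σ) χ.val ψ.val)
  smul_one σ := GroupLike.ext (map_one (conj A σ))

end Points
/-- An affine `K`-group scheme `Spec A` is an algebraic torus if it becomes isomorphic, as a group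
scheme, to `𝔾ₘⁿ` for some `n` over the algebraic closure of `K`. The Hopf algebra of `𝔾ₘⁿ` is the
group algebra of `ℤⁿ`. -/
def IsTorus (K A : Type u) [Field K] [CommRing A] [HopfAlgebra K A] : Prop :=
  ∃ n : ℕ, Nonempty (AlgebraicClosure K ⊗[K] A ≃ₐc[AlgebraicClosure K]
    AddMonoidAlgebra (AlgebraicClosure K) (Fin n → ℤ))

/-- The character group `T̂ = Hom(T_K̄, 𝔾ₘ)`, written additively. -/
abbrev CharacterModule (K A : Type u) [Field K] [CommRing A] [HopfAlgebra K A] : Type u :=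
  Additive (Characters K A (AlgebraicClosure K))

/-- The Galois module structure on the (additively written) characters. -/
instance instDistribMulActionCharacters (K A L : Type u) [Field K] [CommRing A] [HopfAlgebra K A] [Field L] [Algebra K L] :
    DistribMulAction Gal(L/K) (Additive (Characters K A L)) where
  smul σ χ := Additive.ofMul (σ • χ.toMul)
  one_smul χ := congrArg Additive.ofMul (one_smul _ χ.toMul)
  mul_smul σ τ χ := congrArg Additive.ofMul (mul_smul σ τ χ.toMul)
  smul_zero σ := congrArg Additive.ofMul (smul_one (N := Characters K A L) σ)
  smul_add σ χ ψ := congrArg Additive.ofMul (smul_mul' σ χ.toMul ψ.toMul)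

section NumberField

variable (K A : Type u) [Field K] [NumberField K] [CommRing A] [HopfAlgebra K A]

/-- The subgroup `T_v^c = {x ∈ T(K_v) : |χ(x)|_v = 1 for all characters χ of T over K_v}` of
`T(K_v)`, for a finite place `v`. (The characters defined over `K_v` are the Galois invariants
`H⁰(K_v, T̂_v)`.) -/
def maxCompact (v : HeightOneSpectrum (𝓞 K)) : Subgroup (Points K A (v.adicCompletion K)) where
  carrier := { x | ∀ χ : Characters K A (v.adicCompletion K), Valued.v (χ.eval x) = 1 }
  one_mem' χ := by rw [χ.eval_one, map_one]
  mul_mem' hx hy χ := by rw [χ.eval_mul, map_mul, hx χ, hy χ, one_mul]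
  inv_mem' {x} hx χ := by
    have h : Valued.v (χ.eval (x⁻¹)) * Valued.v (χ.eval x) = 1 := by
      rw [← map_mul, ← χ.eval_mul, inv_mul_cancel, χ.eval_one, map_one]
    rwa [hx χ, mul_one] at h

/-- The group of `S`-units `T(O_{K,S}) = T_{𝔸,S} ∩ T(K)` of `T`, where
`T_{𝔸,S} = ∏_{v ∈ S} T(K_v) × ∏_{v ∉ S} T_v^c`: the points of `T(K)` whose image in `T(K_v)` lies
in `T_v^c` for every place `v ∉ S`. Here `S` is given by its finite places. -/
def sUnits (S : Set (HeightOneSpectrum (𝓞 K))) : Subgroup (Points K A K) :=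
  ⨅ (v : HeightOneSpectrum (𝓞 K)) (_ : v ∉ S),
    (maxCompact K A v).comap (Points.map (Algebra.ofId K (v.adicCompletion K)))

end NumberField

section generic
variable (P : MorphismProperty Scheme.{u}) [P.IsMultiplicative] [P.IsStableUnderBaseChange]
  [P.HasOfPostcompProperty P]

lemma isContinuous_forget_aux (S : Scheme.{u}) :
    (MorphismProperty.Over.forget P ⊤ S ⋙ Over.forget S).IsContinuous
      (S.smallGrothendieckTopology P (Q := P)) (Scheme.grothendieckTopology P) := by
  have : RepresentablyFlat (MorphismProperty.Over.forget P ⊤ S) := flat_of_preservesFiniteLimits _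
  have : (MorphismProperty.Over.forget P ⊤ S).IsContinuous
      (S.smallGrothendieckTopology P (Q := P)) ((Scheme.grothendieckTopology P).over S) := by
    rw [Functor.isContinuous_iff_coverPreserving]
    exact Functor.coverPreserving_restrictedTopology _ _
  exact Functor.isContinuous_comp _ _ _ ((Scheme.grothendieckTopology P).over S) _

lemma flat_pullback_aux {X Y : Scheme.{u}} (f : X ⟶ Y) :
    RepresentablyFlat (MorphismProperty.Over.pullback P ⊤ f) := flat_of_preservesFiniteLimits _

/-- Base change along `f`, as a functor from `Y`-schemes to `X`-schemes with property `P`. -/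
def overPullback (P : MorphismProperty Scheme.{u}) [P.IsStableUnderBaseChange]
    {X Y : Scheme.{u}} (f : X ⟶ Y) : P.Over ⊤ Y ⥤ P.Over ⊤ X :=
  MorphismProperty.Over.pullback P ⊤ f

end generic

/-- The functor `V ↦ V ×_Y X` from étale `Y`-schemes to étale `X`-schemes. -/
def etalePullback {X Y : Scheme.{u}} (f : X ⟶ Y) : Y.Etale ⥤ X.Etale :=
  @overPullback @Etale Etale.etale_isStableUnderBaseChange X Y f

/-- The projection `V ×_Y X → V`. -/
def etalePullbackFst {X Y : Scheme.{u}} (f : X ⟶ Y) (V : Y.Etale) :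
    ((etalePullback f).obj V).left ⟶ V.left :=
  Limits.pullback.fst V.hom f

lemma etalePullback_hom {X Y : Scheme.{u}} (f : X ⟶ Y) (V : Y.Etale) :
    ((etalePullback f).obj V).hom = Limits.pullback.snd V.hom f := rfl

lemma etalePullback_map_fst {X Y : Scheme.{u}} (f : X ⟶ Y) {V W : Y.Etale} (g : V ⟶ W) :
    ((etalePullback f).map g).left ≫ etalePullbackFst f W = etalePullbackFst f V ≫ g.left := 
  Limits.pullback.lift_fst _ _ _

theorem isContinuous_forget (S : Scheme.{u}) :
    (Scheme.Etale.forget S ⋙ Over.forget S).IsContinuous S.smallEtaleTopology Scheme.etaleTopology :=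
  @isContinuous_forget_aux @Etale _ _ _ S

lemma subcanonical_etale : Scheme.etaleTopology.{u}.Subcanonical :=
  .of_le Scheme.etaleTopology_le_proetaleTopology

instance isContinuous_etalePullback {X Y : Scheme.{u}} (f : X ⟶ Y) :
    (etalePullback f).IsContinuous Y.smallEtaleTopology X.smallEtaleTopology := by
  have : RepresentablyFlat (etalePullback f) := @flat_pullback_aux @Etale _ _ _ X Y f
  rw [Functor.isContinuous_iff_coverPreserving]
  constructor
  intro V S hS
  obtain ⟨ι, Z, g, rfl⟩ := S.exists_eq_ofArrows
  rw [Scheme.ofArrows_mem_smallEtaleTopology_iff] at hS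
  rw [Sieve.ofArrows, ← Sieve.generate_map_eq_functorPushforward, Presieve.map_ofArrows,
    ← Sieve.ofArrows, Scheme.ofArrows_mem_smallEtaleTopology_iff]
  ext v
  simp only [Set.mem_iUnion, Set.mem_univ, iff_true]
  obtain ⟨i, z, hz⟩ : ∃ i, ∃ z, (g i).left z = etalePullbackFst f V v := by
    have := Set.mem_univ (etalePullbackFst f V v)
    rw [← hS] at this
    simpa using this
  obtain ⟨t, ht1, ht2⟩ := Scheme.Pullback.exists_preimage_pullback z v hz
  have cond : (Limits.pullback.fst (g i).left (etalePullbackFst f V)) ≫ (Z i).hom =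
      (Limits.pullback.snd (g i).left (etalePullbackFst f V) ≫ Limits.pullback.snd V.hom f) ≫ f := by
    have h1 : (g i).left ≫ V.hom = (Z i).hom := CategoryTheory.Over.w ((Scheme.Etale.forget Y).map (g i))
    refine (congrArg (_ ≫ ·) h1).symm.trans ?_
    refine (Category.assoc _ _ _).symm.trans ?_
    refine (congrArg (· ≫ V.hom) Limits.pullback.condition).trans ?_
    refine (Category.assoc _ _ _).trans (.trans ?_ (Category.assoc _ _ _).symm)
    exact congrArg (Limits.pullback.snd (g i).left (etalePullbackFst f V) ≫ ·)
      Limits.pullback.condition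
  let w : Limits.pullback (g i).left (etalePullbackFst f V) ⟶ ((etalePullback f).obj (Z i)).left :=
    Limits.pullback.lift _ _ cond
  have hw : w ≫ ((etalePullback f).map (g i)).left =
      Limits.pullback.snd (g i).left (etalePullbackFst f V) := by
    apply Limits.pullback.hom_ext
    · have h2 := etalePullback_map_fst f (g i)
      have h3 : w ≫ etalePullbackFst f (Z i) = Limits.pullback.fst _ _ :=
        Limits.pullback.lift_fst _ _ _
      refine (Category.assoc _ _ _).trans ?_
      refine (congrArg (w ≫ ·) h2).trans ?_
      refine (Category.assoc _ _ _).symm.trans ?_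
      refine (congrArg (· ≫ (g i).left) h3).trans ?_
      exact Limits.pullback.condition
    · refine (Category.assoc _ _ _).trans ?_
      refine (congrArg (w ≫ ·) (CategoryTheory.Over.w
        ((Scheme.Etale.forget X).map ((etalePullback f).map (g i))))).trans ?_
      exact Limits.pullback.lift_snd _ _ _
  refine ⟨i, w t, ?_⟩
  rw [← ht2, ← hw]
  rfl

/-- The direct image `f_*` of étale sheaves of abelian groups, `(f_* F)(V) = F(V ×_Y X)`. -/
def etalePushforward {X Y : Scheme.{u}} (f : X ⟶ Y) :
    Sheaf X.smallEtaleTopology Ab.{u} ⥤ Sheaf Y.smallEtaleTopology Ab.{u} :=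
  (etalePullback f).sheafPushforwardContinuous _ _ _


/-- The geometric point `Spec K̄ → Spec K`. -/
def geomPt (K : Type u) [Field K] :
    Spec (.of (AlgebraicClosure K)) ⟶ Spec (.of K) :=
  Spec.map (CommRingCat.ofHom (algebraMap K (AlgebraicClosure K)))

/-- The set `V(K̄)` of `K`-morphisms `Spec K̄ → V`, for `V` étale over `Spec K`. -/
def GeomPoints (K : Type u) [Field K] (V : (Spec (.of K)).Etale) : Type u :=
  { p : Spec (.of (AlgebraicClosure K)) ⟶ V.left // p ≫ V.hom = geomPt K }

/-- The action of the absolute Galois group on `V(K̄)`. -/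
instance (K : Type u) [Field K] (V : (Spec (.of K)).Etale) :
    SMul Gal(AlgebraicClosure K/K) (GeomPoints K V) where
  smul σ p := ⟨Spec.map (CommRingCat.ofHom (σ : AlgebraicClosure K →+* AlgebraicClosure K)) ≫ p.1, by
    rw [Category.assoc, p.2, geomPt, ← Spec.map_comp, ← CommRingCat.ofHom_comp]
    congr 2
    ext x
    exact σ.commutes x⟩

/-- The map `V(K̄) → W(K̄)` induced by a morphism `V → W`. -/
def GeomPoints.map {K : Type u} [Field K] {V W : (Spec (.of K)).Etale} (f : V ⟶ W)
    (p : GeomPoints K V) : GeomPoints K W :=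
  ⟨p.1 ≫ f.left, (Category.assoc _ _ _).trans ((congrArg (p.1 ≫ ·) (CategoryTheory.Over.w
    ((Scheme.Etale.forget _).map f))).trans p.2)⟩

lemma GeomPoints.map_smul {K : Type u} [Field K] {V W : (Spec (.of K)).Etale} (f : V ⟶ W)
    (σ : Gal(AlgebraicClosure K/K)) (p : GeomPoints K V) :
    (σ • p).map f = σ • p.map f :=
  Subtype.ext (Category.assoc _ _ _)

lemma GeomPoints.map_map {K : Type u} [Field K] {V W Z : (Spec (.of K)).Etale} (f : V ⟶ W)
    (g : W ⟶ Z) (p : GeomPoints K V) :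
    (p.map f).map g = p.map (f ≫ g) :=
  Subtype.ext (Category.assoc _ _ _)

lemma GeomPoints.exists_lift {K : Type u} [Field K] {V : (Spec (.of K)).Etale}
    {S : Sieve V} (hS : S ∈ Scheme.smallEtaleTopology _ V) (p : GeomPoints K V) :
    ∃ (W : (Spec (.of K)).Etale) (f : W ⟶ V) (_ : S f) (q : GeomPoints K W), q.map f = p := by
  obtain ⟨ι, Z, g, rfl⟩ := S.exists_eq_ofArrows
  rw [Scheme.ofArrows_mem_smallEtaleTopology_iff] at hS
  obtain ⟨i, z, hz⟩ : ∃ i, ∃ z, (g i).left z = p.1 default := by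
    have := Set.mem_univ (p.1 default)
    rw [← hS] at this
    simpa using this
  obtain ⟨l, hl, -⟩ := Scheme.exists_fac_of_etale_of_isSepClosed (g i).left p.1 z hz
  refine ⟨Z i, g i, Sieve.ofArrows_mk _ _ i, ⟨l, ?_⟩, Subtype.ext hl⟩
  rw [← p.2, ← hl]
  refine .trans ?_ (Category.assoc _ _ _).symm
  exact congrArg (l ≫ ·) (CategoryTheory.Over.w ((Scheme.Etale.forget _).map (g i))).symm

lemma GeomPoints.exists_pullback {K : Type u} [Field K] {V W W' : (Spec (.of K)).Etale}
    (f : W ⟶ V) (f' : W' ⟶ V) (q : GeomPoints K W) (q' : GeomPoints K W')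
    (h : q.map f = q'.map f') :
    ∃ (Z : (Spec (.of K)).Etale) (g : Z ⟶ W) (g' : Z ⟶ W') (r : GeomPoints K Z),
      g ≫ f = g' ≫ f' ∧ r.map g = q ∧ r.map g' = q' := by
  let F := Scheme.Etale.forget (Spec (.of K)) ⋙ coyoneda.obj (op (Over.mk (geomPt K)))
  let e {T : (Spec (.of K)).Etale} (p : GeomPoints K T) : F.Elements :=
    F.elementsMk T (Over.homMk p.1 p.2)
  let φ : e q ⟶ e (q.map f) := CategoryOfElements.homMk _ _ f rfl
  let φ' : e q' ⟶ e (q.map f) := CategoryOfElements.homMk _ _ f' (by rw [h]; rfl)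
  obtain ⟨z, g, g', hg⟩ := IsCofiltered.cospan φ φ'
  refine ⟨z.1, g.1, g'.1, ⟨z.2.left, CategoryTheory.Over.w z.2⟩, congrArg Subtype.val hg, ?_, ?_⟩
  · exact Subtype.ext (congrArg CommaMorphism.left g.2)
  · exact Subtype.ext (congrArg CommaMorphism.left g'.2)

/-- The group of Galois-equivariant maps `V(K̄) → M`. -/
def equivariantMaps (K : Type u) [Field K] (M : Type u) [AddCommGroup M]
    [DistribMulAction Gal(AlgebraicClosure K/K) M] (V : (Spec (.of K)).Etale) :
    AddSubgroup (GeomPoints K V → M) where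
  carrier := { s | ∀ (σ : Gal(AlgebraicClosure K/K)) p, s (σ • p) = σ • s p }
  add_mem' hs ht σ p := by simp [hs σ p, ht σ p]
  zero_mem' σ p := by simp
  neg_mem' hs σ p := by simp [hs σ p]

/-- The presheaf `V ↦ Hom_{G_K}(V(K̄), M)` on the étale site of `Spec K`. -/
def galoisPresheaf (K : Type u) [Field K] (M : Type u) [AddCommGroup M]
    [DistribMulAction Gal(AlgebraicClosure K/K) M] : (Spec (.of K)).Etaleᵒᵖ ⥤ Ab.{u} where
  obj V := AddCommGrpCat.of (equivariantMaps K M V.unop)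
  map f := AddCommGrpCat.ofHom
    { toFun s := ⟨fun p => s.1 (p.map f.unop), fun σ p =>
        (congrArg s.1 (GeomPoints.map_smul _ _ _)).trans (s.2 _ _)⟩
      map_zero' := rfl
      map_add' _ _ := rfl }
  map_id V := by
    ext s p
    have h : p.map (𝟙 V).unop = p := Subtype.ext (Category.comp_id _)
    exact congrArg s.1 h
  map_comp f g := by
    ext s p
    exact congrArg s.1 (Subtype.ext (Category.assoc _ _ _).symm)

lemma isSheaf_galoisPresheaf (K : Type u) [Field K] (M : Type u) [AddCommGroup M]
    [DistribMulAction Gal(AlgebraicClosure K/K) M] :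
    Presheaf.IsSheaf (Scheme.smallEtaleTopology _) (galoisPresheaf K M) := by
  apply Presheaf.isSheaf_of_isSheaf_comp _ _ (forget Ab)
  rw [isSheaf_iff_isSheaf_of_type]
  intro V S hS x hx
  let y {W} (f : W ⟶ V) (hf : S f) : equivariantMaps K M W := x f hf
  have key : ∀ {W W' : (Spec (.of K)).Etale} (f : W ⟶ V) (hf : S f) (f' : W' ⟶ V) (hf' : S f')
      (q : GeomPoints K W) (q' : GeomPoints K W'), q.map f = q'.map f' →
      (y f hf).1 q = (y f' hf').1 q' := by
    intro W W' f hf f' hf' q q' h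
    obtain ⟨Z, g, g', r, hg, rfl, rfl⟩ := GeomPoints.exists_pullback f f' q q' h
    have := hx g g' hf hf' hg
    exact congrFun (congrArg Subtype.val
      (show ((galoisPresheaf K M).map g.op (y f hf) : equivariantMaps K M Z) =
        ((galoisPresheaf K M).map g'.op (y f' hf') : equivariantMaps K M Z) from this)) r
  choose W f hf q hq using fun p => GeomPoints.exists_lift hS p
  let t : equivariantMaps K M V := ⟨fun p => (y (f p) (hf p)).1 (q p), fun σ p => by
    rw [← (y (f p) (hf p)).2]
    apply key
    rw [hq, GeomPoints.map_smul, hq]⟩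
  refine ⟨t, fun Z g hg => ?_, fun t' ht' => ?_⟩
  · refine Subtype.ext (funext fun r => ?_)
    exact key _ _ g hg _ _ (hq _)
  · refine Subtype.ext (funext fun p => ?_)
    have h1 := congrFun (congrArg Subtype.val
      (show ((galoisPresheaf K M).map (f p).op t' : equivariantMaps K M (W p)) =
        y (f p) (hf p) from ht' (f p) (hf p))) (q p)
    refine .trans ?_ h1
    exact congrArg (show equivariantMaps K M V from t').1 (hq p).symm

/-- The étale sheaf on `Spec K` corresponding to a (discrete) `G_K`-module `M`:
`V ↦ Hom_{G_K}(V(K̄), M)`. -/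
def galoisSheaf (K : Type u) [Field K] (M : Type u) [AddCommGroup M]
    [DistribMulAction Gal(AlgebraicClosure K/K) M] :
    Sheaf (Spec (.of K)).smallEtaleTopology Ab.{u} :=
  ⟨galoisPresheaf K M, isSheaf_galoisPresheaf K M⟩

/-- The presheaf `V ↦ Γ(V, 𝒪_V)ˣ` on the étale site of `X`. -/
def unitsPresheaf (X : Scheme.{u}) : X.Etaleᵒᵖ ⥤ Ab.{u} where
  obj V := AddCommGrpCat.of (Additive Γ(V.unop.left, ⊤)ˣ)
  map f := AddCommGrpCat.ofHom (Units.map (f.unop.left.appTop.hom : _ →* _)).toAdditive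
  map_id V := by
    ext s
    apply Additive.toMul.injective
    apply Units.ext
    exact congrArg (fun h => h.hom (Additive.toMul s).1) (Scheme.Hom.id_appTop (X := V.unop.left))
  map_comp f g := by
    ext s
    apply Additive.toMul.injective
    apply Units.ext
    exact congrArg (fun h => h.hom (Additive.toMul s).1) (Scheme.Hom.comp_appTop g.unop.left f.unop.left)

/-- The presheaf of sets `V ↦ Γ(V, 𝒪_V)` on the étale site of `X`. -/
def functionsPresheaf (X : Scheme.{u}) : X.Etaleᵒᵖ ⥤ Type u :=
  (Scheme.Etale.forget X ⋙ Over.forget X).op ⋙ Scheme.Γ ⋙ forget CommRingCat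

lemma isSheaf_functionsPresheaf (X : Scheme.{u}) :
    Presieve.IsSheaf X.smallEtaleTopology (functionsPresheaf X) := by
  have := subcanonical_etale.{u}
  have := isContinuous_forget X
  have h1 := GrothendieckTopology.Subcanonical.isSheaf_of_isRepresentable (J := Scheme.etaleTopology.{u})
    (yoneda.obj (Spec (.of (MvPolynomial PUnit.{u+1} (ULift.{u} ℤ)))))
  have h2 := Functor.op_comp_isSheaf_of_isSheaf_type
    (Scheme.Etale.forget X ⋙ Over.forget X) X.smallEtaleTopology h1
  refine Presieve.isSheaf_iso _ (NatIso.ofComponents (fun V => Equiv.toIso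
    ((AffineSpace.toSpecMvPolyIntEquiv PUnit).trans (Equiv.funUnique PUnit _))) ?_) h2
  intro V W f
  rfl

lemma isSheaf_unitsPresheaf (X : Scheme.{u}) :
    Presheaf.IsSheaf X.smallEtaleTopology (unitsPresheaf X) := by
  apply Presheaf.isSheaf_of_isSheaf_comp _ _ (forget Ab)
  rw [isSheaf_iff_isSheaf_of_type]
  intro V S hS x hx
  let y {W} (f : W ⟶ V) (hf : S f) : Γ(W.left, ⊤)ˣ := (show Additive Γ(W.left, ⊤)ˣ from x f hf).toMul
  have hy : ∀ {W W' Z : X.Etale} (g : Z ⟶ W) (g' : Z ⟶ W') (f : W ⟶ V) (hf : S f) (f' : W' ⟶ V)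
     (hf' : S f') (_ : g ≫ f = g' ≫ f'),
      Units.map (g.left.appTop.hom : _ →* Γ(Z.left, ⊤)) (y f hf) =
      Units.map (g'.left.appTop.hom : _ →* Γ(Z.left, ⊤)) (y f' hf') :=
    fun g g' f hf f' hf' h => congrArg Additive.toMul (hx g g' hf hf' h)
  have hO := isSheaf_functionsPresheaf X S hS
  obtain ⟨a, ha, ha'⟩ := hO (fun W f hf => (y f hf).1) (fun W W' Z g g' f f' hf hf' h =>
    congrArg Units.val (hy g g' f hf f' hf' h))
  obtain ⟨b, hb, hb'⟩ := hO (fun W f hf => (y f hf)⁻¹.1) (fun W W' Z g g' f f' hf hf' h => by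
    have := congrArg (fun z => z⁻¹) (hy g g' f hf f' hf' h)
    simp only [← map_inv] at this
    exact congrArg Units.val this)
  have hsep := (isSheaf_functionsPresheaf X).isSeparated S hS
  have hab : (show Γ(V.left, ⊤) from a) * (show Γ(V.left, ⊤) from b) = 1 := by
    refine hsep.ext fun W f hf => ?_
    have h1 : f.left.appTop.hom (show Γ(V.left, ⊤) from a) = (y f hf).1 := ha f hf
    have h2 : f.left.appTop.hom (show Γ(V.left, ⊤) from b) = (y f hf)⁻¹.1 := hb f hf
    have h3 : f.left.appTop.hom ((show Γ(V.left, ⊤) from a) * (show Γ(V.left, ⊤) from b)) =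
        f.left.appTop.hom 1 := by
      rw [map_mul, h1, h2, Units.mul_inv, map_one]
    exact h3
  let t : Γ(V.left, ⊤)ˣ := ⟨a, b, hab, (mul_comm _ _).trans hab⟩
  refine ⟨Additive.ofMul t, fun W f hf => ?_, fun t' ht' => ?_⟩
  · exact congrArg Additive.ofMul (Units.ext (ha f hf))
  · refine congrArg Additive.ofMul (Units.ext (ha' (Additive.toMul t').1 fun W f hf => ?_))
    exact congrArg (fun z => (Additive.toMul z).1) (ht' f hf)

/-- The étale sheaf `𝔾ₘ` on `X`. -/
def multiplicativeSheaf (X : Scheme.{u}) : Sheaf X.smallEtaleTopology Ab.{u} :=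
  ⟨unitsPresheaf X, isSheaf_unitsPresheaf X⟩

/-- The value in `Ω` of a section of `𝔾ₘ` over `V` at a point `Spec Ω → V`. -/
def unitValue {X : Scheme.{u}} {V : X.Etale} {Ω : Type u} [Field Ω]
    (p : Spec (.of Ω) ⟶ V.left) (s : Additive Γ(V.left, ⊤)ˣ) : Ω :=
  (Scheme.ΓSpecIso (.of Ω)).hom (p.appTop (Additive.toMul s : Γ(V.left, ⊤)ˣ).val)

/-- The étale sheaf on `Spec K` given by the Galois module `T̂`. -/
def characterSheaf (K A : Type u) [Field K] [CommRing A] [HopfAlgebra K A] :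
    Sheaf (Spec (.of K)).smallEtaleTopology Ab.{u} :=
  galoisSheaf K (CharacterModule K A)

section SIntegers

variable (K : Type u) [Field K] [NumberField K] (S : Set (HeightOneSpectrum (𝓞 K)))

/-- `U = Spec O_{K,S}`. -/
def specSIntegers : Scheme.{u} := Spec (.of (S.integer K))

/-- The inclusion `j : Spec K → U` of the generic point. -/
def genericInclusion : Spec (.of K) ⟶ specSIntegers K S :=
  Spec.map (CommRingCat.ofHom (algebraMap (S.integer K) K))

end SIntegers

end EtaleTori

end

open EtaleTori

noncomputable section

namespace EtaleTori

/-! A homomorphism `j_* T̂ → 𝔾ₘ` is determined by its stalk at the geometric generic point, a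
Galois-equivariant homomorphism `f : T̂ → K̄ˣ` (`PushforwardHom.exists_stalk`). Over `K̄` the
coordinate ring of a torus is the group algebra of `T̂`, so `f` is evaluation at a unique `x ∈ T(K)`
(`Points.exists_eval_eq`, `Points.eq_of_eval_eq`). It remains to see that the points arising in this
way are exactly the `S`-units.

Let `x` be an `S`-unit and `v ∉ S`. Over an algebraic closure of `K_v`, the product of the
`K_v`-conjugates of a character `χ` is defined over `K_v`, so its value at `x` has absolute value
one. The conjugate values all have the same spectral norm, which is therefore one. Hence the minimal
polynomial of `χ(x)` has `v`-integral coefficients for all `v ∉ S`, and `χ(x)` is integral over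
`O_{K,S}` (`isIntegral_eval_of_mem_sUnits`). Integral closure commutes with étale base change, so an
equivariant function with integral values on the geometric points of an étale `U`-scheme is a
regular function (`exists_function`). This gives the homomorphism attached to `x`.

Conversely, let `φ` have stalk evaluation at `x`, and let `ψ` be a character over `K_v`, `v ∉ S`. It
comes from some `χ ∈ T̂` (`Characters.map_surjective`), whose field of definition `L` embeds in
`K_v`. The induced valuation on `L` has the value group of `v`, so its centre `q` is unramified over
`K` (`exists_isUnramifiedAt_of_valuation`). Thus `χ` extends to a section of `j_* T̂` over an étale
neighbourhood of `q`. There `φ` sends it to a unit whose value and inverse value at the geometric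
point land in the valuation ring of `K_v`, that is, `|ψ(x)|_v = 1` (`mem_sUnits_of_value_eq`). -/

lemma repr_semilinear_apply {ι L M X Y : Type*} [Field L] [Field M] [AddCommGroup X]
    [AddCommGroup Y] [Module L X] [Module M Y] {σ : L →+* M} (b : Module.Basis ι L X)
    (b' : Module.Basis ι M Y) (f : X →ₛₗ[σ] Y) (h : ∀ i, f (b i) = b' i) (x : X) (i : ι) :
    b'.repr (f x) i = σ (b.repr x i) := by
  have hx : x ∈ Submodule.span L (Set.range b) := b.span_eq ▸ Submodule.mem_top
  induction hx using Submodule.span_induction with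
  | mem x hx =>
    obtain ⟨j, rfl⟩ := hx
    classical simp [h, Finsupp.single_apply, apply_ite σ]
  | zero => simp
  | add x y _ _ hx hy => simp [hx, hy]
  | smul c x _ hx => simp [hx]

lemma semilinear_injective_of_basis {ι L M X Y : Type*} [Field L] [Field M] [AddCommGroup X]
    [AddCommGroup Y] [Module L X] [Module M Y] {σ : L →+* M} (b : Module.Basis ι L X)
    (b' : Module.Basis ι M Y) (f : X →ₛₗ[σ] Y) (h : ∀ i, f (b i) = b' i) :
    Function.Injective f := by
  intro x y hxy
  apply b.repr.injective
  ext i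
  apply σ.injective
  rw [← repr_semilinear_apply b b' f h, ← repr_semilinear_apply b b' f h, hxy]

/-! ### Base change of characters along field extensions -/

section BaseMap

variable {K L M N : Type u} [Field K] [Field L] [Algebra K L] [Field M] [Algebra K M]
  [Field N] [Algebra K N] (A : Type u) [CommRing A] [HopfAlgebra K A]

/-- The homomorphism `L ⊗[K] A → M ⊗[K] A` induced by a homomorphism `L → M` of extensions. -/
def baseMap (ι : L →ₐ[K] M) : L ⊗[K] A →ₐ[K] M ⊗[K] A :=
  Algebra.TensorProduct.map ι (AlgHom.id K A)

/-- `baseMap` as a semilinear map. -/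
def baseMapₛₗ (ι : L →ₐ[K] M) : L ⊗[K] A →ₛₗ[(ι : L →+* M)] M ⊗[K] A where
  toFun := baseMap A ι
  map_add' := map_add _
  map_smul' l z := by
    rw [Algebra.smul_def, map_mul, Algebra.smul_def]
    simp [baseMap]

lemma baseMapₛₗ_basis (ι : L →ₐ[K] M) {I : Type*} (b : Module.Basis I K A) (i : I) :
    baseMapₛₗ A ι (Algebra.TensorProduct.basis L b i) = Algebra.TensorProduct.basis M b i := by
  simp [baseMapₛₗ, baseMap]

lemma baseMap_injective (ι : L →ₐ[K] M) : Function.Injective (baseMap A ι) :=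
  semilinear_injective_of_basis _ _ (baseMapₛₗ A ι)
    (baseMapₛₗ_basis A ι (Module.Free.chooseBasis K A))

/-- Product bases go to product bases. Injectivity on the tensor square is what lets the equation
`Δz = z ⊗ z` descend. -/
lemma map_baseMapₛₗ_injective (ι : L →ₐ[K] M) :
    Function.Injective (TensorProduct.map (baseMapₛₗ A ι) (baseMapₛₗ A ι)) := by
  let b := Module.Free.chooseBasis K A
  refine semilinear_injective_of_basis
    ((Algebra.TensorProduct.basis L b).tensorProduct (Algebra.TensorProduct.basis L b))
    ((Algebra.TensorProduct.basis M b).tensorProduct (Algebra.TensorProduct.basis M b)) _ ?_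
  rintro ⟨i, j⟩
  rw [Module.Basis.tensorProduct_apply, Module.Basis.tensorProduct_apply, TensorProduct.map_tmul,
    baseMapₛₗ_basis, baseMapₛₗ_basis]

lemma counit_baseMap (ι : L →ₐ[K] M) (z : L ⊗[K] A) :
    Coalgebra.counit (R := M) (baseMap A ι z) = ι (Coalgebra.counit (R := L) z) := by
  induction z with
  | zero => simp
  | add a b ha hb => simp only [map_add, ha, hb]
  | tmul a b => simp [baseMap, Algebra.smul_def]

lemma comul_baseMap (ι : L →ₐ[K] M) (z : L ⊗[K] A) :
    Coalgebra.comul (R := M) (baseMap A ι z) =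
      TensorProduct.map (baseMapₛₗ A ι) (baseMapₛₗ A ι) (Coalgebra.comul (R := L) z) := by
  have h1 : ∀ l (w : A ⊗[K] A),
      TensorProduct.AlgebraTensorModule.tensorTensorTensorComm K M K M M M A A
          ((((1 : M) ⊗ₜ[M] ι l)) ⊗ₜ[K] w) = TensorProduct.map (baseMapₛₗ A ι) (baseMapₛₗ A ι)
          (TensorProduct.AlgebraTensorModule.tensorTensorTensorComm K L K L L L A A
          (((1 : L) ⊗ₜ[L] l) ⊗ₜ[K] w)) := by
    intro l w
    induction w with
    | zero => simp
    | add a b ha hb => simp only [TensorProduct.tmul_add, map_add, ha, hb]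
    | tmul a b => simp [baseMapₛₗ, baseMap]
  induction z with
  | zero => rw [map_zero, LinearMap.map_zero, LinearMap.map_zero, LinearMap.map_zero]
  | add a b ha hb =>
    rw [map_add (baseMap A ι), LinearMap.map_add, ha, hb, LinearMap.map_add, LinearMap.map_add]
  | tmul a b =>
    have e1 : baseMap A ι (a ⊗ₜ[K] b) = ι a ⊗ₜ[K] b := rfl
    have e2 := TensorProduct.comul_tmul (R := K) (S := M) (ι a) b
    have e3 := TensorProduct.comul_tmul (R := K) (S := L) a b
    refine ((congrArg _ e1).trans e2).trans (Eq.trans ?_ (congrArg _ e3.symm))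
    rw [CommSemiring.comul_apply, CommSemiring.comul_apply]
    exact h1 a _

/-- Counit and comultiplication commute with base change, and the maps involved are injective. The
forward implication is the one needed for Galois descent of characters. -/
lemma isGroupLikeElem_baseMap_iff (ι : L →ₐ[K] M) {z : L ⊗[K] A} :
    IsGroupLikeElem M (baseMap A ι z) ↔ IsGroupLikeElem L z := by
  have h : baseMap A ι z ⊗ₜ[M] baseMap A ι z =
      TensorProduct.map (baseMapₛₗ A ι) (baseMapₛₗ A ι) (z ⊗ₜ z) := by
    rw [TensorProduct.map_tmul]; rfl
  constructor
  · intro hz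
    refine ⟨ι.toRingHom.injective ?_, map_baseMapₛₗ_injective A ι ?_⟩
    · have := hz.counit_eq_one
      rw [counit_baseMap] at this
      simpa using this
    · rw [← h, ← comul_baseMap, hz.comul_eq_tmul_self]
  · intro hz
    refine ⟨?_, ?_⟩
    · rw [counit_baseMap, hz.counit_eq_one, map_one]
    · rw [comul_baseMap, hz.comul_eq_tmul_self, h]

lemma baseMap_comp (ι : L →ₐ[K] M) (κ : M →ₐ[K] N) (z : L ⊗[K] A) :
    baseMap A κ (baseMap A ι z) = baseMap A (κ.comp ι) z := by
  induction z with
  | zero => simp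
  | add a b ha hb => simp only [map_add, ha, hb]
  | tmul a b => simp [baseMap]

variable {A}

/-- The homomorphism of character groups induced by a homomorphism of extensions of `K`. -/
def Characters.map (ι : L →ₐ[K] M) : Characters K A L →* Characters K A M where
  toFun χ := ⟨baseMap A ι χ.val, (isGroupLikeElem_baseMap_iff A ι).2 χ.2⟩
  map_one' := GroupLike.ext (map_one (baseMap A ι))
  map_mul' χ ψ := GroupLike.ext (map_mul (baseMap A ι) χ.val ψ.val)

lemma Characters.map_val (ι : L →ₐ[K] M) (χ : Characters K A L) :
    (χ.map ι).val = baseMap A ι χ.val := rfl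

lemma Characters.map_injective (ι : L →ₐ[K] M) :
    Function.Injective (Characters.map (A := A) ι) := fun _ _ h =>
  GroupLike.ext (baseMap_injective A ι (congrArg GroupLike.val h))

lemma Characters.map_map (ι : L →ₐ[K] M) (κ : M →ₐ[K] N) (χ : Characters K A L) :
    (χ.map ι).map κ = χ.map (κ.comp ι) := GroupLike.ext (baseMap_comp A ι κ _)

lemma Characters.smul_eq_map (σ : Gal(L/K)) (χ : Characters K A L) :
    σ • χ = χ.map (σ : L →ₐ[K] L) := rfl

lemma Characters.eval_map (ι : L →ₐ[K] M) (χ : Characters K A L) (x : Points K A L) :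
    (χ.map ι).eval (Points.map ι x) = ι (χ.eval x) := by
  rw [Characters.eval, Characters.eval, Characters.map_val]
  induction χ.val with
  | zero => simp
  | add a b ha hb => simp only [map_add, ha, hb]
  | tmul a b =>
    have : (Points.map ι x).hom b = ι (x.hom b) := rfl
    simp [baseMap, Points.baseChange, this]

lemma Points.map_map (ι : L →ₐ[K] M) (κ : M →ₐ[K] N) (x : Points K A L) :
    Points.map κ (Points.map ι x) = Points.map (κ.comp ι) x := rfl

lemma Characters.eval_map_ofId (ι : L →ₐ[K] M) (χ : Characters K A L) (x : Points K A K) :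
    (χ.map ι).eval (Points.map (Algebra.ofId K M) x) =
      ι (χ.eval (Points.map (Algebra.ofId K L) x)) := by
  rw [← Characters.eval_map, Points.map_map, Subsingleton.elim (Algebra.ofId K M)
    (ι.comp (Algebra.ofId K L))]

lemma Characters.eval_smul_ofId (σ : Gal(L/K)) (χ : Characters K A L) (x : Points K A K) :
    (σ • χ).eval (Points.map (Algebra.ofId K L) x) =
      σ (χ.eval (Points.map (Algebra.ofId K L) x)) :=
  Characters.eval_map_ofId (σ : L →ₐ[K] L) χ x

end BaseMap

/-! ### Galois descent of characters -/

section Descent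

variable {K k Ω A : Type u} [Field K] [Field k] [Field Ω] [Algebra K k] [Algebra k Ω]
  [Algebra K Ω] [IsScalarTower K k Ω] [CommRing A] [HopfAlgebra K A]

/-- In a basis coming from `A` the Galois group acts coordinatewise, so the coordinates of an
invariant element lie in `k`. -/
lemma exists_baseMap_eq_of_invariant [IsGalois k Ω] (z : Ω ⊗[K] A)
    (hz : ∀ σ : Gal(Ω/k), baseMap A (σ.restrictScalars K : Ω →ₐ[K] Ω) z = z) :
    ∃ w : k ⊗[K] A, baseMap A (IsScalarTower.toAlgHom K k Ω) w = z := by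
  let b := Module.Free.chooseBasis K A
  have h : ∀ i, ∃ c : k, algebraMap k Ω c = (Algebra.TensorProduct.basis Ω b).repr z i := by
    intro i
    refine InfiniteGalois.mem_range_algebraMap_iff_fixed _ |>.2 fun σ => ?_
    have := repr_semilinear_apply _ _ (baseMapₛₗ A (σ.restrictScalars K : Ω →ₐ[K] Ω))
      (baseMapₛₗ_basis A _ b) z i
    refine this.symm.trans ?_
    exact congrArg (fun y => (Algebra.TensorProduct.basis Ω b).repr y i) (hz σ)
  choose c hc using h
  let f : _ →₀ k := Finsupp.onFinset ((Algebra.TensorProduct.basis Ω b).repr z).support c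
    fun i hi => by
      rw [Finsupp.mem_support_iff, ← hc]
      simpa using hi
  refine ⟨(Algebra.TensorProduct.basis k b).repr.symm f, ?_⟩
  apply (Algebra.TensorProduct.basis Ω b).repr.injective
  ext i
  refine (repr_semilinear_apply _ _ (baseMapₛₗ A (IsScalarTower.toAlgHom K k Ω))
      (baseMapₛₗ_basis A _ b) _ i).trans ?_
  rw [LinearEquiv.apply_symm_apply]
  exact hc i

lemma Characters.exists_map_eq_of_invariant [IsGalois k Ω] (χ : Characters K A Ω)
    (hχ : ∀ σ : Gal(Ω/k), σ.restrictScalars K • χ = χ) :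
    ∃ ψ : Characters K A k, ψ.map (IsScalarTower.toAlgHom K k Ω) = χ := by
  obtain ⟨w, hw⟩ := exists_baseMap_eq_of_invariant (k := k) χ.val
    fun σ => congrArg GroupLike.val (hχ σ)
  exact ⟨⟨w, (isGroupLikeElem_baseMap_iff A _).1 (hw ▸ χ.2)⟩, GroupLike.ext hw⟩

end Descent

/-! ### Characters and points of a torus -/

section Torus

variable {K A : Type u} [Field K] [CommRing A] [HopfAlgebra K A]

local notation "K̄" => AlgebraicClosure K

/-- The monomials of the group algebra of `ℤⁿ` are group-like and span it. -/
lemma IsTorus.span_characters (hA : IsTorus K A) :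
    Submodule.span K̄ (Set.range fun χ : Characters K A K̄ => χ.val) = ⊤ := by
  obtain ⟨n, ⟨e⟩⟩ := hA
  rw [eq_top_iff]
  rintro z -
  suffices ∀ y, e.symm y ∈
      Submodule.span K̄ (Set.range fun χ : Characters K A K̄ => χ.val) by
    simpa using this (e z)
  intro y
  induction y using AddMonoidAlgebra.induction_linear with
  | zero => rw [map_zero]; exact zero_mem _
  | add f g hf hg => rw [map_add]; exact add_mem hf hg
  | single a b =>
    have : (AddMonoidAlgebra.single a b : AddMonoidAlgebra K̄ (Fin n → ℤ)) =
      b • AddMonoidAlgebra.single a 1 := by simp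
    rw [this, map_smul]
    refine Submodule.smul_mem _ _ (Submodule.subset_span ⟨⟨_, ?_⟩, rfl⟩)
    exact (isGroupLikeElem_map_equiv e.symm).2
      (AddMonoidAlgebra.isGroupLikeElem_of (R := K̄) a)

lemma span_range_baseMap {L M : Type u} [Field L] [Algebra K L] [Field M] [Algebra K M]
    (ι : L →ₐ[K] M) (s : Set (L ⊗[K] A)) (hs : Submodule.span L s = ⊤) :
    Submodule.span M (baseMap A ι '' s) = ⊤ := by
  rw [eq_top_iff]
  rintro z -
  have key : ∀ y : L ⊗[K] A, baseMap A ι y ∈ Submodule.span M (baseMap A ι '' s) := by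
    intro y
    have hy : y ∈ Submodule.span L s := hs ▸ Submodule.mem_top
    induction hy using Submodule.span_induction with
    | mem x h => exact Submodule.subset_span ⟨x, h, rfl⟩
    | zero => rw [map_zero]; exact zero_mem _
    | add x y _ _ hx hy => rw [map_add]; exact add_mem hx hy
    | smul a x _ hx =>
      rw [show baseMap A ι (a • x) = ι a • baseMap A ι x from (baseMapₛₗ A ι).map_smulₛₗ a x]
      exact Submodule.smul_mem _ _ hx
  induction z with
  | zero => exact zero_mem _
  | add a b ha hb => exact add_mem ha hb
  | tmul a b =>
    have : a ⊗ₜ[K] b = a • baseMap A ι (1 ⊗ₜ b) := by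
      simp [baseMap, TensorProduct.smul_tmul']
    rw [this]
    exact Submodule.smul_mem _ _ (key _)

/-- Distinct group-like elements are linearly independent. The characters coming from `K̄` already
span `Ω ⊗[K] A`, so there is no room for another one. -/
lemma Characters.map_surjective (hA : IsTorus K A) {Ω : Type u} [Field Ω] [Algebra K Ω]
    (ι : K̄ →ₐ[K] Ω) : Function.Surjective (Characters.map (A := A) ι) := by
  intro ψ
  by_contra! hψ
  have hspan := span_range_baseMap ι _ hA.span_characters
  have hli := linearIndep_groupLikeVal (R := Ω) (A := Ω ⊗[K] A)
  have hmem : ψ.val ∈ Submodule.span Ω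
      ((GroupLike.val (R := Ω) (A := Ω ⊗[K] A)) '' (Set.range (Characters.map (A := A) ι))) := by
    have : (GroupLike.val (R := Ω) (A := Ω ⊗[K] A)) '' (Set.range (Characters.map (A := A) ι)) =
      baseMap A ι '' (Set.range fun χ : Characters K A K̄ => χ.val) := by
      rw [← Set.range_comp, ← Set.range_comp]; rfl
    rw [this, hspan]
    trivial
  refine hli.notMem_span_image ?_ hmem
  rintro ⟨χ, hχ⟩
  exact hψ χ hχ

lemma Points.baseChange_eq_of_eval_eq (hA : IsTorus K A) (x y : Points K A K̄)
    (h : ∀ χ : Characters K A K̄, χ.eval x = χ.eval y) : x = y := by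
  have : x.baseChange.toLinearMap = y.baseChange.toLinearMap :=
    LinearMap.ext_on hA.span_characters (by rintro _ ⟨χ, rfl⟩; exact h χ)
  refine WithConv.ext (AlgHom.ext fun a => ?_)
  have := congrArg (fun f => f (1 ⊗ₜ[K] a)) this
  simpa [Points.baseChange, Points.hom] using this

lemma Points.eq_of_eval_eq (hA : IsTorus K A) (x y : Points K A K)
    (h : ∀ χ : Characters K A K̄, χ.eval (Points.map (Algebra.ofId K K̄) x) =
      χ.eval (Points.map (Algebra.ofId K K̄) y)) : x = y := by
  have := Points.baseChange_eq_of_eval_eq hA _ _ h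
  refine WithConv.ext (AlgHom.ext fun a => ?_)
  apply (algebraMap K K̄).injective
  exact congrArg (fun z => z.hom a) this

/-- Every equivariant homomorphism `T̂ → K̄ˣ` is evaluation at a point of `T(K)`. -/
lemma Points.exists_eval_eq [PerfectField K] (hA : IsTorus K A) (f : Characters K A K̄ →* K̄)
    (hf : ∀ (σ : Gal(K̄/K)) χ, f (σ • χ) = σ (f χ)) :
    ∃ x : Points K A K, ∀ χ : Characters K A K̄,
      χ.eval (Points.map (Algebra.ofId K K̄) x) = f χ := by
  -- The characters are independent and span, so `K̄ ⊗[K] A` is the group algebra of `T̂`, and `f`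
  -- extends to an algebra homomorphism `ℓ`.
  have hb : Function.Bijective (MonoidAlgebra.lift K̄ (K̄ ⊗[K] A) (Characters K A K̄)
      (GroupLike.valMonoidHom K̄ (K̄ ⊗[K] A))) := by
    have : ∀ z, MonoidAlgebra.lift K̄ (K̄ ⊗[K] A) (Characters K A K̄)
      (GroupLike.valMonoidHom K̄ (K̄ ⊗[K] A)) z =
        Finsupp.linearCombination K̄ GroupLike.val z.coeff := fun z => by
        rw [MonoidAlgebra.lift_apply]; rfl
    refine ⟨fun y z hyz => ?_, fun z => ?_⟩
    · rw [this, this] at hyz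
      have := (linearIndep_groupLikeVal (R := K̄) (A := K̄ ⊗[K] A)) hyz
      exact MonoidAlgebra.coeff_injective this
    · have hz : z ∈ Submodule.span K̄ (Set.range fun χ : Characters K A K̄ => χ.val) :=
        hA.span_characters ▸ Submodule.mem_top
      obtain ⟨c, hc⟩ := Finsupp.mem_span_range_iff_exists_finsupp.1 hz
      refine ⟨.ofCoeff c, ?_⟩
      rw [this]
      exact hc
  let E := AlgEquiv.ofBijective _ hb
  let ℓ : K̄ ⊗[K] A →ₐ[K̄] K̄ := (MonoidAlgebra.lift K̄ K̄ (Characters K A K̄) f).comp E.symm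
  have hℓ : ∀ χ : Characters K A K̄, ℓ χ.val = f χ := by
    intro χ
    have : E.symm χ.val = MonoidAlgebra.of _ _ χ := by
      rw [AlgEquiv.symm_apply_eq]
      simp [E]
    change MonoidAlgebra.lift K̄ K̄ (Characters K A K̄) f (E.symm χ.val) = _
    rw [this]
    simp
  have hσ : ∀ (σ : Gal(K̄/K)) z, ℓ (conj A σ z) = σ (ℓ z) := by
    intro σ z
    have hz : z ∈ Submodule.span K̄ (Set.range fun χ : Characters K A K̄ => χ.val) :=
        hA.span_characters ▸ Submodule.mem_top
    induction hz using Submodule.span_induction with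
    | mem x h =>
      obtain ⟨χ, rfl⟩ := h
      rw [show conj A σ χ.val = (σ • χ).val from rfl, hℓ, hℓ, hf]
    | zero => simp
    | add x y _ _ hx hy => simp only [map_add, hx, hy]
    | smul a x _ hx =>
      rw [show conj A σ (a • x) = σ a • conj A σ x from (conjₛₗ A σ).map_smulₛₗ a x, map_smul, hx,
        map_smul, smul_eq_mul, smul_eq_mul, map_mul]
  let y : A →ₐ[K] K̄ := (ℓ.restrictScalars K).comp Algebra.TensorProduct.includeRight
  -- Elements `1 ⊗ a` are Galois-invariant, so equivariance of `ℓ` puts its values on them in `K`.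
  have hy : ∀ a, y a ∈ (Algebra.ofId K K̄).range := by
    intro a
    refine InfiniteGalois.mem_range_algebraMap_iff_fixed (y a) |>.2 fun σ => ?_
    change σ (ℓ (1 ⊗ₜ a)) = ℓ (1 ⊗ₜ a)
    rw [← hσ]
    simp [conj]
  let x : A →ₐ[K] K := (AlgEquiv.ofInjective (Algebra.ofId K K̄)
    (algebraMap K K̄).injective).symm.toAlgHom.comp (y.codRestrict _ hy)
  have hx : (Algebra.ofId K K̄).comp x = y := by
    ext a
    change Algebra.ofId K K̄ ((AlgEquiv.ofInjective (Algebra.ofId K K̄)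
      (algebraMap K K̄).injective).symm (y.codRestrict _ hy a)) = _
    have := AlgEquiv.apply_symm_apply (AlgEquiv.ofInjective (Algebra.ofId K K̄)
      (algebraMap K K̄).injective) (y.codRestrict _ hy a)
    exact congrArg Subtype.val this
  refine ⟨WithConv.toConv x, fun χ => ?_⟩
  have : Points.baseChange (Points.map (Algebra.ofId K K̄) (WithConv.toConv x)) = ℓ := by
    ext a
    have : (Points.map (Algebra.ofId K K̄) (WithConv.toConv x) : Points K A K̄).hom = y := hx
    simp [Points.baseChange, this, y]
  rw [Characters.eval, this, hℓ]

end Torus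

/-! ### Étale algebras and equivariant functions on their geometric points -/

section Affine

variable {K : Type u} [Field K]

local notation "K̄" => AlgebraicClosure K

lemma exists_gal_apply_eq {L : Type u} [Field L] [Algebra K L] (ι q : L →ₐ[K] K̄) :
    ∃ σ : Gal(K̄/K), ∀ x, σ (ι x) = q x := by
  let := ι.toRingHom.toAlgebra
  have : IsScalarTower K L K̄ := .of_algebraMap_eq fun x => (ι.commutes x).symm
  refine ⟨AlgEquiv.ofBijective (q.liftNormal K̄) (AlgHom.normal_bijective K K̄ K̄ _), fun x => ?_⟩
  exact q.liftNormal_commutes K̄ x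

/-- The idempotents `Pi.single i 1` sum to one, so some one of them is not killed; in a field its
image must be `1`. -/
lemma exists_proj_of_algHom_pi {I : Type u} [Finite I] {L : I → Type u} [∀ i, Field (L i)]
    [∀ i, Algebra K (L i)] {E : Type u} [Field E] [Algebra K E] (p : (Π i, L i) →ₐ[K] E) :
    ∃ (i : I) (q : L i →ₐ[K] E), ∀ x, p x = q (x i) := by
  classical
  cases nonempty_fintype I
  obtain ⟨i, hi⟩ : ∃ i, p (Pi.single i 1) ≠ 0 := by
    by_contra! h
    have h1 : p (∑ i, Pi.single i (1 : L i)) = 1 := by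
      rw [show (∑ i, Pi.single i (1 : L i)) = 1 from Finset.univ_sum_single 1, map_one]
    rw [map_sum, Finset.sum_eq_zero fun i _ => h i] at h1
    exact zero_ne_one h1
  have hi1 : p (Pi.single i 1) = 1 := by
    have : p (Pi.single i 1) * p (Pi.single i 1) = p (Pi.single i 1) * 1 := by
      rw [← map_mul, ← Pi.single_mul, mul_one, mul_one]
    exact mul_left_cancel₀ hi this
  let q : L i →ₐ[K] E := AlgHom.mk'
    { toFun y := p (Pi.single i y)
      map_one' := hi1
      map_mul' x y := by rw [Pi.single_mul, map_mul]
      map_zero' := by simp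
      map_add' x y := by rw [Pi.single_add, map_add] }
    fun c x => by
      change p (Pi.single i (c • x)) = c • p (Pi.single i x)
      rw [← map_smul, Pi.single_smul]
  refine ⟨i, q, fun x => ?_⟩
  change p x = p (Pi.single i (x i))
  have : Pi.single i (x i) = x * Pi.single i 1 := by
    ext j
    obtain rfl | h := eq_or_ne j i
    · simp
    · simp [Pi.single_eq_of_ne h]
  rw [this, map_mul, hi1, mul_one]

lemma eq_of_forall_algHom_eq_of_etale {D : Type u} [CommRing D] [Algebra K D] [Algebra.Etale K D]
    {x y : D} (h : ∀ p : D →ₐ[K] K̄, p x = p y) : x = y := by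
  obtain ⟨I, _, L, _, _, e, hL⟩ := (Algebra.Etale.iff_exists_algEquiv_prod K D).1 inferInstance
  apply e.injective
  ext i
  have := (hL i).1
  let ι : L i →ₐ[K] K̄ := IsAlgClosed.lift
  apply ι.toRingHom.injective
  exact h ((ι.comp (Pi.evalAlgHom K L i)).comp e)

/-- Split `D` into fields `L i` and choose one embedding of each into `K̄`. By equivariance the
prescribed value there is fixed by the stabilizer of the image of `L i`, hence lies in that image.
All other points are conjugate to the chosen ones. -/
lemma exists_forall_algHom_eq_of_etale {D : Type u} [CommRing D] [Algebra K D] [Algebra.Etale K D]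
    [PerfectField K] (F : (D →ₐ[K] K̄) → K̄)
    (hF : ∀ (σ : Gal(K̄/K)) p, F ((σ : K̄ →ₐ[K] K̄).comp p) = σ (F p)) :
    ∃ d : D, ∀ p : D →ₐ[K] K̄, p d = F p := by
  obtain ⟨I, _, L, _, _, e, hL⟩ := (Algebra.Etale.iff_exists_algEquiv_prod K D).1 inferInstance
  have := fun i => (hL i).1
  let ι (i : I) : L i →ₐ[K] K̄ := IsAlgClosed.lift
  let P (i : I) : D →ₐ[K] K̄ := ((ι i).comp (Pi.evalAlgHom K L i)).comp e
  have key : ∀ i, ∃ y : L i, ι i y = F (P i) := by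
    intro i
    have : F (P i) ∈ IntermediateField.fixedField (ι i).fieldRange.fixingSubgroup := by
      rw [IntermediateField.mem_fixedField_iff]
      intro σ hσ
      rw [← hF]
      congr 1
      ext x
      exact hσ ⟨_, ⟨_, rfl⟩⟩
    rw [InfiniteGalois.fixedField_fixingSubgroup] at this
    exact this
  choose y hy using key
  refine ⟨e.symm y, fun p => ?_⟩
  obtain ⟨i, q, hq⟩ := exists_proj_of_algHom_pi (p.comp (e.symm : (Π i, L i) →ₐ[K] D))
  obtain ⟨σ, hσ⟩ := exists_gal_apply_eq (ι i) q
  have hp : p = (σ : K̄ →ₐ[K] K̄).comp (P i) := by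
    ext x
    have h1 : p (e.symm (e x)) = q (e x i) := hq (e x)
    rw [AlgEquiv.symm_apply_apply] at h1
    rw [h1]
    exact (hσ _).symm
  have h1 : p (e.symm y) = q (y i) := hq y
  rw [h1, hp, hF, ← hσ, hy]

lemma isIntegral_pi {R I : Type*} [CommRing R] [Finite I] {L : I → Type*} [∀ i, CommRing (L i)]
    [∀ i, Algebra R (L i)] {x : Π i, L i} (h : ∀ i, IsIntegral R (x i)) : IsIntegral R x := by
  cases nonempty_fintype I
  choose f hf hx using h
  refine ⟨∏ i, f i, Polynomial.monic_prod_of_monic _ _ fun i _ => hf i, ?_⟩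
  rw [← Polynomial.aeval_def]
  ext i
  rw [← Pi.evalAlgHom_apply R L i (Polynomial.aeval x _), ← Polynomial.aeval_algHom_apply,
    map_prod]
  exact Finset.prod_eq_zero (Finset.mem_univ i) (hx i)

lemma isIntegral_of_forall_algHom {R D : Type u} [CommRing R] [Algebra R K] [CommRing D]
    [Algebra K D] [Algebra R D] [IsScalarTower R K D] [Algebra.Etale K D] {d : D}
    (h : ∀ p : D →ₐ[K] K̄, IsIntegral R (p d)) : IsIntegral R d := by
  obtain ⟨I, _, L, _, _, e, hL⟩ := (Algebra.Etale.iff_exists_algEquiv_prod K D).1 inferInstance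
  let _ (i : I) : Algebra R (L i) := ((algebraMap K (L i)).comp (algebraMap R K)).toAlgebra
  have (i : I) : IsScalarTower R K (L i) := .of_algebraMap_eq fun _ => rfl
  rw [← isIntegral_algHom_iff ((e : D →ₐ[K] Π i, L i).restrictScalars R) e.injective]
  refine isIntegral_pi fun i => ?_
  have := (hL i).1
  let ι : L i →ₐ[K] K̄ := IsAlgClosed.lift
  rw [← isIntegral_algHom_iff (ι.restrictScalars R) ι.toRingHom.injective]
  exact h ((ι.comp (Pi.evalAlgHom K L i)).comp e)

variable {R B : Type u} [CommRing R] [Algebra R K] [CommRing B] [Algebra R B]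
  [Algebra.Etale R B]

/-- By flatness `B` embeds in its generic fibre `K ⊗[R] B`, where geometric points separate
elements. -/
lemma eq_of_forall_algHom_eq [FaithfulSMul R K] {x y : B}
    (h : ∀ p : B →ₐ[R] K̄, p x = p y) : x = y := by
  have hinj : Function.Injective (Algebra.TensorProduct.includeRight : B →ₐ[R] K ⊗[R] B) :=
    Algebra.TensorProduct.includeRight_injective (FaithfulSMul.algebraMap_injective R K)
  apply hinj
  exact eq_of_forall_algHom_eq_of_etale fun p =>
    h ((p.restrictScalars R).comp Algebra.TensorProduct.includeRight)

/-- The function exists on the generic fibre and is integral over `R` there. Since `B` is smooth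
over `R`, the integral closure of `B` in `B ⊗[R] K` is generated by that of `R` in `K`, so the
function lies in `B`. -/
lemma exists_forall_algHom_eq [PerfectField K] [IsIntegrallyClosedIn R K] (F : (B →ₐ[R] K̄) → K̄)
    (hF : ∀ (σ : Gal(K̄/K)) p, F (((σ : K̄ →ₐ[K] K̄).restrictScalars R).comp p) = σ (F p))
    (hint : ∀ p, IsIntegral R (F p)) :
    ∃ b : B, ∀ p : B →ₐ[R] K̄, p b = F p := by
  let j : B →ₐ[R] K ⊗[R] B := Algebra.TensorProduct.includeRight
  obtain ⟨d, hd⟩ := exists_forall_algHom_eq_of_etale (D := K ⊗[R] B)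
    (fun p => F ((p.restrictScalars R).comp j)) fun σ p => hF σ ((p.restrictScalars R).comp j)
  have hdi : IsIntegral R d := isIntegral_of_forall_algHom fun p => by
    rw [hd]; exact hint _
  let c := Algebra.TensorProduct.comm R K B
  have hci : IsIntegral B (c d) :=
    ((isIntegral_algHom_iff (c : K ⊗[R] B →ₐ[R] B ⊗[R] K) c.injective).2 hdi).tower_top
  obtain ⟨z, hz⟩ := (TensorProduct.toIntegralClosure_bijective_of_smooth (R := R) (S := B)
    (B := K)).2 ⟨_, hci⟩
  have hz' : Algebra.TensorProduct.map (AlgHom.id B B) (integralClosure R K).val z = c d :=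
    congrArg Subtype.val hz
  obtain ⟨b, hb⟩ : ∃ b : B, Algebra.TensorProduct.map (AlgHom.id B B) (integralClosure R K).val z =
      b ⊗ₜ 1 := by
    clear hz hz'
    induction z with
    | zero => exact ⟨0, by simp⟩
    | add x y hx hy =>
      obtain ⟨b, hb⟩ := hx
      obtain ⟨b', hb'⟩ := hy
      exact ⟨b + b', by rw [map_add, hb, hb', TensorProduct.add_tmul]⟩
    | tmul x y =>
      obtain ⟨r, hr⟩ := IsIntegrallyClosedIn.algebraMap_eq_of_integral y.2
      refine ⟨r • x, ?_⟩
      rw [TensorProduct.smul_tmul, Algebra.smul_def, mul_one, hr]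
      rfl
  refine ⟨b, fun p => ?_⟩
  let P : K ⊗[R] B →ₐ[K] K̄ := Algebra.TensorProduct.lift (Algebra.ofId K K̄) p
    fun _ _ => Commute.all _ _
  have h1 : d = j b := c.injective (by rw [← hz', hb]; rfl)
  have h2 : (P.restrictScalars R).comp j = p := by ext; simp [P, j]
  rw [← h2]
  exact (congrArg P h1.symm).trans (hd P)

end Affine

/-- The value in `Ω` of a function on `V` at a point `Spec Ω → V`. -/
def functionValue {V : Scheme.{u}} {Ω : Type u} [Field Ω] (p : Spec (.of Ω) ⟶ V) :
    Γ(V, ⊤) →+* Ω :=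
  (Scheme.ΓSpecIso (.of Ω)).hom.hom.comp p.appTop.hom

lemma functionValue_comp {V W : Scheme.{u}} {Ω : Type u} [Field Ω] (p : Spec (.of Ω) ⟶ V)
    (f : V ⟶ W) (g : Γ(W, ⊤)) :
    functionValue (p ≫ f) g = functionValue p (f.appTop.hom g) := by
  rw [functionValue, Scheme.Hom.comp_appTop]
  rfl

lemma functionValue_SpecMap_comp {V : Scheme.{u}} {Ω Ω' : Type u} [Field Ω] [Field Ω']
    (σ : Ω →+* Ω') (p : Spec (.of Ω) ⟶ V) (g : Γ(V, ⊤)) :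
    functionValue (Spec.map (CommRingCat.ofHom σ) ≫ p) g = σ (functionValue p g) := by
  have := congrArg (fun h => h.hom (p.appTop.hom g))
    (Scheme.ΓSpecIso_naturality (CommRingCat.ofHom σ))
  rw [functionValue, Scheme.Hom.comp_appTop]
  exact this

lemma functionValue_SpecMap {B : CommRingCat.{u}} {Ω : Type u} [Field Ω] (ψ : B →+* Ω)
    (g : Γ(Spec B, ⊤)) :
    functionValue (Spec.map (CommRingCat.ofHom ψ)) g = ψ ((Scheme.ΓSpecIso B).hom.hom g) := by
  exact congrArg (fun h => h.hom g) (Scheme.ΓSpecIso_naturality (CommRingCat.ofHom ψ))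

/-! ### Functions on étale schemes over `Spec R` -/

section Sections

variable {R K : Type u} [CommRing R] [Field K] [Algebra R K]

local notation "K̄" => AlgebraicClosure K

variable (R K) in
/-- The geometric point `Spec K̄ → Spec R`. -/
def geomPtOver : Spec (.of K̄) ⟶ Spec (.of R) :=
  Spec.map (CommRingCat.ofHom (algebraMap R K̄))

lemma SpecMap_gal_comp_geomPtOver (σ : Gal(K̄/K)) :
    Spec.map (CommRingCat.ofHom (σ : K̄ →+* K̄)) ≫ geomPtOver R K = geomPtOver R K := by
  rw [geomPtOver, ← Spec.map_comp, ← CommRingCat.ofHom_comp]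
  congr 2
  ext x
  simp only [RingHom.comp_apply, IsScalarTower.algebraMap_apply R K K̄]
  exact σ.commutes _

lemma SpecMap_comp_eq_geomPtOver_iff {B : Type u} [CommRing B] [Algebra R B] (ψ : B →+* K̄) :
    Spec.map (CommRingCat.ofHom ψ) ≫ Spec.map (CommRingCat.ofHom (algebraMap R B)) =
      geomPtOver R K ↔ ψ.comp (algebraMap R B) = algebraMap R K̄ := by
  rw [geomPtOver, ← Spec.map_comp, ← CommRingCat.ofHom_comp]
  constructor
  · intro h
    exact congrArg CommRingCat.Hom.hom (Spec.map_injective h)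
  · intro h
    rw [h]

lemma exists_algebra_of_etale {B : CommRingCat.{u}} (f : Spec B ⟶ Spec (.of R)) [Etale f] :
    ∃ _ : Algebra R B, Algebra.Etale R B ∧
      f = Spec.map (CommRingCat.ofHom (algebraMap R B)) := by
  obtain ⟨φ, rfl⟩ := Spec.map_surjective f
  have h : φ.hom.Etale := (HasRingHomProperty.Spec_iff (P := @Etale)).1 ‹_›
  exact ⟨φ.hom.toAlgebra, h, rfl⟩

lemma functions_ext_affine [FaithfulSMul R K] {B : CommRingCat.{u}} (f : Spec B ⟶ Spec (.of R))
    [Etale f] {x y : Γ(Spec B, ⊤)}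
    (h : ∀ p : Spec (.of K̄) ⟶ Spec B, p ≫ f = geomPtOver R K →
      functionValue p x = functionValue p y) : x = y := by
  obtain ⟨_, _, rfl⟩ := exists_algebra_of_etale f
  have hinj : Function.Injective (Scheme.ΓSpecIso B).hom.hom :=
    (Scheme.ΓSpecIso B).commRingCatIsoToRingEquiv.injective
  apply hinj
  refine eq_of_forall_algHom_eq (R := R) (K := K) fun p => ?_
  have := h (Spec.map (CommRingCat.ofHom p.toRingHom))
    ((SpecMap_comp_eq_geomPtOver_iff _).2 p.comp_algebraMap)
  rwa [functionValue_SpecMap, functionValue_SpecMap] at this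

lemma exists_function_affine [PerfectField K] [IsIntegrallyClosedIn R K] {B : CommRingCat.{u}}
    (f : Spec B ⟶ Spec (.of R)) [Etale f] (F : (Spec (.of K̄) ⟶ Spec B) → K̄)
    (hF : ∀ (σ : Gal(K̄/K)) p, p ≫ f = geomPtOver R K →
      F (Spec.map (CommRingCat.ofHom (σ : K̄ →+* K̄)) ≫ p) = σ (F p))
    (hint : ∀ p, p ≫ f = geomPtOver R K → IsIntegral R (F p)) :
    ∃ x : Γ(Spec B, ⊤), ∀ p, p ≫ f = geomPtOver R K → functionValue p x = F p := by
  obtain ⟨_, _, rfl⟩ := exists_algebra_of_etale f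
  have hp : ∀ p : B →ₐ[R] K̄, Spec.map (CommRingCat.ofHom p.toRingHom) ≫
      Spec.map (CommRingCat.ofHom (algebraMap R B)) = geomPtOver R K := fun p =>
    (SpecMap_comp_eq_geomPtOver_iff _).2 p.comp_algebraMap
  obtain ⟨b, hb⟩ := exists_forall_algHom_eq (R := R) (K := K) (B := B)
    (fun p => F (Spec.map (CommRingCat.ofHom p.toRingHom)))
    (fun σ p => by
      rw [← hF σ _ (hp p), ← Spec.map_comp, ← CommRingCat.ofHom_comp]
      rfl) (fun p => hint _ (hp p))
  refine ⟨(Scheme.ΓSpecIso B).inv.hom b, fun p hpf => ?_⟩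
  obtain ⟨ψ, rfl⟩ := Spec.map_surjective p
  let P : B →ₐ[R] K̄ := ⟨ψ.hom, fun r => DFunLike.congr_fun
    ((SpecMap_comp_eq_geomPtOver_iff ψ.hom).1 hpf) r⟩
  have := hb P
  refine Eq.trans ?_ this
  refine (functionValue_SpecMap ψ.hom _).trans (congrArg ψ.hom ?_)
  exact congrArg (fun h => h.hom b) (Scheme.ΓSpecIso B).inv_hom_id

/-- The structure morphism of an étale `X`-scheme. -/
def structureHom {X : Scheme.{u}} (V : X.Etale) : V.left ⟶ X := V.hom

instance {X : Scheme.{u}} (V : X.Etale) : Etale (structureHom V) := V.prop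

/-- An open subscheme of an étale `X`-scheme, as an étale `X`-scheme. -/
def openObj {X : Scheme.{u}} (V : X.Etale) {W : Scheme.{u}} (i : W ⟶ V.left)
    [IsOpenImmersion i] : X.Etale :=
  Scheme.Etale.mk (i ≫ structureHom V)

/-- The inclusion of an open subscheme. -/
def openObjHom {X : Scheme.{u}} (V : X.Etale) {W : Scheme.{u}} (i : W ⟶ V.left)
    [IsOpenImmersion i] : openObj V i ⟶ V :=
  MorphismProperty.Over.homMk i rfl

lemma affineCover_mem {X : Scheme.{u}} (V : X.Etale) :
    Sieve.ofArrows _ (fun i => openObjHom V (V.left.affineOpenCover.f i)) ∈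
      X.smallEtaleTopology V := by
  rw [Scheme.ofArrows_mem_smallEtaleTopology_iff]
  ext v
  simp only [Set.mem_iUnion, Set.mem_univ, iff_true]
  obtain ⟨i, w, hw⟩ := V.left.affineOpenCover.openCover.exists_eq v
  exact ⟨i, w, hw⟩

lemma left_comp_structureHom {X : Scheme.{u}} {V W : X.Etale} (f : V ⟶ W) :
    f.left ≫ structureHom W = structureHom V :=
  CategoryTheory.Over.w ((Scheme.Etale.forget X).map f)

/-- A function on an étale `R`-scheme is determined by its values at the `K̄`-points. -/
lemma functions_ext [FaithfulSMul R K] (V : (Spec (.of R)).Etale) {x y : Γ(V.left, ⊤)}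
    (h : ∀ p : Spec (.of K̄) ⟶ V.left, p ≫ structureHom V = geomPtOver R K →
      functionValue p x = functionValue p y) : x = y := by
  refine ((isSheaf_functionsPresheaf _).isSeparated _ (affineCover_mem V)).ext
    fun W f hf => ?_
  obtain ⟨W', g, k, ⟨i⟩, rfl⟩ := hf
  have hx : (V.left.affineOpenCover.f i).appTop.hom x =
      (V.left.affineOpenCover.f i).appTop.hom y := by
    refine functions_ext_affine (K := K) (V.left.affineOpenCover.f i ≫ structureHom V)
      fun p hp => ?_
    rw [← functionValue_comp, ← functionValue_comp]
    exact h _ ((Category.assoc _ _ _).trans hp)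
  have h2 := congrArg (g.left.appTop.hom) hx
  exact h2

/-- An equivariant function on the `K̄`-points of an étale `R`-scheme with integral values comes
from a global function, if `R` is integrally closed in `K`. -/
lemma exists_function [FaithfulSMul R K] [PerfectField K] [IsIntegrallyClosedIn R K]
    (V : (Spec (.of R)).Etale) (F : (Spec (.of K̄) ⟶ V.left) → K̄)
    (hF : ∀ (σ : Gal(K̄/K)) p, p ≫ structureHom V = geomPtOver R K →
      F (Spec.map (CommRingCat.ofHom (σ : K̄ →+* K̄)) ≫ p) = σ (F p))
    (hint : ∀ p, p ≫ structureHom V = geomPtOver R K → IsIntegral R (F p)) :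
    ∃ x : Γ(V.left, ⊤), ∀ p, p ≫ structureHom V = geomPtOver R K → functionValue p x = F p := by
  -- `T` consists of the morphisms to `V` over whose source the desired function exists. It contains
  -- an affine cover, hence is covering, and the local solutions can be glued.
  let T : Sieve V :=
    { arrows W f := ∃ x : Γ(W.left, ⊤), ∀ p, p ≫ structureHom W = geomPtOver R K →
        functionValue p x = F (p ≫ f.left)
      downward_closed := by
        rintro W W' f ⟨x, hx⟩ g
        refine ⟨g.left.appTop.hom x, fun p hp => ?_⟩
        have h1 : (p ≫ g.left) ≫ structureHom W = geomPtOver R K := by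
          rw [Category.assoc, left_comp_structureHom, hp]
        rw [← functionValue_comp, hx _ h1]
        exact congrArg F (Category.assoc _ _ _) }
  have hTi : ∀ i, T (openObjHom V (V.left.affineOpenCover.f i)) := by
    intro i
    refine exists_function_affine (V.left.affineOpenCover.f i ≫ structureHom V)
      (fun p => F (p ≫ V.left.affineOpenCover.f i)) ?_ ?_
    · intro σ p hp
      rw [← hF]
      · rw [Category.assoc]
      · rwa [Category.assoc]
    · intro p hp
      exact hint _ ((Category.assoc _ _ _).trans hp)
  have hT : T ∈ (Spec (.of R)).smallEtaleTopology V := by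
    refine GrothendieckTopology.superset_covering _ ?_ (affineCover_mem V)
    rintro W f ⟨W', g, k, ⟨i⟩, rfl⟩
    exact T.downward_closed (hTi i) g
  let x {W : (Spec (.of R)).Etale} (f : W ⟶ V) (hf : T f) : Γ(W.left, ⊤) := hf.choose
  have hx {W : (Spec (.of R)).Etale} (f : W ⟶ V) (hf : T f) (p)
      (hp : p ≫ structureHom W = geomPtOver R K) :
      functionValue p (x f hf) = F (p ≫ f.left) := hf.choose_spec p hp
  obtain ⟨a, ha⟩ : ∃ a : Γ(V.left, ⊤), ∀ (W : (Spec (.of R)).Etale) (f : W ⟶ V) (hf : T f),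
      f.left.appTop.hom a = x f hf := (isSheaf_functionsPresheaf _ T hT (fun W f hf => x f hf) (by
    intro W W' Z g g' f f' hf hf' h
    change g.left.appTop.hom (x f hf) = g'.left.appTop.hom (x f' hf')
    -- Local solutions agree on overlaps because functions are determined by their values.
    refine functions_ext (K := K) Z fun p hp => ?_
    rw [← functionValue_comp, ← functionValue_comp, hx _ _ _, hx _ _ _]
    · have := congrArg (fun k => F (p ≫ k.left)) h
      refine Eq.trans ?_ (this.trans ?_)
      · exact congrArg F (Category.assoc _ _ _)
      · exact congrArg F (Category.assoc _ _ _).symm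
    · rw [Category.assoc, left_comp_structureHom, hp]
    · rw [Category.assoc, left_comp_structureHom, hp])).exists
  refine ⟨a, fun p hp => ?_⟩
  obtain ⟨i, w, hw⟩ : ∃ (i : V.left.affineOpenCover.I₀) (w : _),
      V.left.affineOpenCover.f i w = p default :=
    V.left.affineOpenCover.openCover.exists_eq (p default)
  let q := IsOpenImmersion.lift (V.left.affineOpenCover.f i) p (by
    rintro _ ⟨z, rfl⟩
    rw [Subsingleton.elim z default]
    exact ⟨w, hw⟩)
  have hq : q ≫ V.left.affineOpenCover.f i = p := IsOpenImmersion.lift_fac _ _ _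
  let f := openObjHom V (V.left.affineOpenCover.f i)
  have hf : T f := hTi i
  have h1 : f.left.appTop.hom a = x f hf := ha _ f hf
  have h2 := (congrArg (functionValue q) h1).trans (hx f hf q ?_)
  · rw [← hq]
    exact (functionValue_comp q _ a).trans h2
  · rw [← hp, ← hq]
    exact (Category.assoc _ _ _).symm

end Sections

/-! ### Homomorphisms from the direct image to `𝔾ₘ` and their generic stalk -/

section Pushforward

variable {R K : Type u} [CommRing R] [Field K] [Algebra R K]

local notation "K̄" => AlgebraicClosure K

variable (R K) in
/-- The morphism `Spec K → Spec R`. -/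
def genericPt : Spec (.of K) ⟶ Spec (.of R) := Spec.map (CommRingCat.ofHom (algebraMap R K))

lemma geomPt_comp_genericPt : geomPt K ≫ genericPt R K = geomPtOver R K := by
  rw [geomPt, genericPt, geomPtOver, ← Spec.map_comp, ← CommRingCat.ofHom_comp,
    ← IsScalarTower.algebraMap_eq]

/-- The geometric point of the generic fibre defined by a geometric point of an étale scheme. -/
def liftPt (V : (Spec (.of R)).Etale) (p : Spec (.of K̄) ⟶ V.left)
    (hp : p ≫ structureHom V = geomPtOver R K) :
    GeomPoints K ((etalePullback (genericPt R K)).obj V) :=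
  ⟨Limits.pullback.lift p (geomPt K) (hp.trans geomPt_comp_genericPt.symm),
    Limits.pullback.lift_snd _ _ _⟩

lemma liftPt_fst (V : (Spec (.of R)).Etale) (p : Spec (.of K̄) ⟶ V.left)
    (hp : p ≫ structureHom V = geomPtOver R K) :
    (liftPt V p hp).1 ≫ etalePullbackFst (genericPt R K) V = p :=
  Limits.pullback.lift_fst _ _ _

lemma comp_fst_comp_structureHom (V : (Spec (.of R)).Etale)
    (q : GeomPoints K ((etalePullback (genericPt R K)).obj V)) :
    (q.1 ≫ etalePullbackFst (genericPt R K) V) ≫ structureHom V = geomPtOver R K := by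
  refine Eq.trans ?_ ((congrArg (· ≫ genericPt R K) q.2).trans geomPt_comp_genericPt)
  refine (Category.assoc _ _ _).trans (.trans ?_ (Category.assoc _ _ _).symm)
  exact congrArg (q.1 ≫ ·) Limits.pullback.condition

lemma geomPoints_pullback_ext (V : (Spec (.of R)).Etale)
    {q q' : GeomPoints K ((etalePullback (genericPt R K)).obj V)}
    (h : q.1 ≫ etalePullbackFst (genericPt R K) V = q'.1 ≫ etalePullbackFst (genericPt R K) V) :
    q = q' :=
  Subtype.ext (Limits.pullback.hom_ext h (q.2.trans q'.2.symm))

lemma liftPt_comp_fst (V : (Spec (.of R)).Etale)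
    (q : GeomPoints K ((etalePullback (genericPt R K)).obj V)) :
    liftPt V (q.1 ≫ etalePullbackFst (genericPt R K) V) (comp_fst_comp_structureHom V q) = q :=
  geomPoints_pullback_ext V (liftPt_fst V _ _)

lemma SpecMap_gal_comp_structureHom (V : (Spec (.of R)).Etale) {p : Spec (.of K̄) ⟶ V.left}
    (hp : p ≫ structureHom V = geomPtOver R K) (σ : Gal(K̄/K)) :
    (Spec.map (CommRingCat.ofHom (σ : K̄ →+* K̄)) ≫ p) ≫ structureHom V = geomPtOver R K := by
  rw [Category.assoc, hp, SpecMap_gal_comp_geomPtOver]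

lemma smul_comp_fst (V : (Spec (.of R)).Etale) (σ : Gal(K̄/K))
    (q : GeomPoints K ((etalePullback (genericPt R K)).obj V)) :
    (σ • q).1 ≫ etalePullbackFst (genericPt R K) V =
      Spec.map (CommRingCat.ofHom (σ : K̄ →+* K̄)) ≫
        (q.1 ≫ etalePullbackFst (genericPt R K) V) :=
  Category.assoc _ _ _

lemma liftPt_smul (V : (Spec (.of R)).Etale) {p : Spec (.of K̄) ⟶ V.left}
    (hp : p ≫ structureHom V = geomPtOver R K) (σ : Gal(K̄/K)) :
    liftPt V _ (SpecMap_gal_comp_structureHom V hp σ) = σ • liftPt V p hp :=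
  geomPoints_pullback_ext V (by rw [liftPt_fst, smul_comp_fst, liftPt_fst])

lemma map_comp_fst {V W : (Spec (.of R)).Etale} (f : V ⟶ W)
    (q : GeomPoints K ((etalePullback (genericPt R K)).obj V)) :
    (q.map ((etalePullback (genericPt R K)).map f)).1 ≫ etalePullbackFst (genericPt R K) W =
      (q.1 ≫ etalePullbackFst (genericPt R K) V) ≫ f.left := by
  rw [Category.assoc, ← etalePullback_map_fst, ← Category.assoc]
  rfl

lemma comp_left_comp_structureHom {V W : (Spec (.of R)).Etale} (f : V ⟶ W)
    {p : Spec (.of K̄) ⟶ V.left} (hp : p ≫ structureHom V = geomPtOver R K) :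
    (p ≫ f.left) ≫ structureHom W = geomPtOver R K := by
  rw [Category.assoc, left_comp_structureHom, hp]

lemma map_liftPt {V W : (Spec (.of R)).Etale} (f : V ⟶ W) {p : Spec (.of K̄) ⟶ V.left}
    (hp : p ≫ structureHom V = geomPtOver R K) :
    (liftPt V p hp).map ((etalePullback (genericPt R K)).map f) =
      liftPt W (p ≫ f.left) (comp_left_comp_structureHom f hp) :=
  geomPoints_pullback_ext W (by rw [map_comp_fst, liftPt_fst, liftPt_fst])

variable {M : Type u} [AddCommGroup M] [DistribMulAction Gal(AlgebraicClosure K/K) M]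

/-- The group of homomorphisms from the direct image of the sheaf of a Galois module to `𝔾ₘ`. -/
abbrev PushforwardHom (R K M : Type u) [CommRing R] [Field K] [Algebra R K]
    [AddCommGroup M] [DistribMulAction Gal(AlgebraicClosure K/K) M] : Type (u + 1) :=
  (etalePushforward (genericPt R K)).obj (galoisSheaf K M) ⟶ multiplicativeSheaf (Spec (.of R))

/-- Sections over `V` of the direct image of the sheaf of a Galois module. -/
abbrev Sections (R K M : Type u) [CommRing R] [Field K] [Algebra R K]
    [AddCommGroup M] [DistribMulAction Gal(AlgebraicClosure K/K) M]
    (V : (Spec (.of R)).Etale) : Type u :=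
  equivariantMaps K M ((etalePullback (genericPt R K)).obj V)

/-- Restriction of sections. -/
def Sections.res {V W : (Spec (.of R)).Etale} (f : V ⟶ W) (s : Sections R K M W) :
    Sections R K M V :=
  ⟨fun q => s.1 (q.map ((etalePullback (genericPt R K)).map f)), fun _ _ =>
    (congrArg s.1 (GeomPoints.map_smul _ _ _)).trans (s.2 _ _)⟩

/-- The image of a section under a homomorphism to `𝔾ₘ`. -/
def PushforwardHom.unit (φ : PushforwardHom R K M) {V : (Spec (.of R)).Etale}
    (s : Sections R K M V) : Γ(V.left, ⊤)ˣ :=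
  Additive.toMul (show Additive Γ(V.left, ⊤)ˣ from φ.hom.app (op V) s)

lemma PushforwardHom.unit_res (φ : PushforwardHom R K M) {V W : (Spec (.of R)).Etale} (f : V ⟶ W)
    (s : Sections R K M W) :
    (φ.unit (s.res f)).val = f.left.appTop.hom (φ.unit s).val := by
  have h := congrArg (fun g => g.hom s) (φ.hom.naturality f.op)
  exact congrArg (fun y : Additive Γ(V.left, ⊤)ˣ => (Additive.toMul y).val) h

lemma PushforwardHom.unit_add (φ : PushforwardHom R K M) {V : (Spec (.of R)).Etale}
    (s t : Sections R K M V) : φ.unit (s + t) = φ.unit s * φ.unit t :=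
  congrArg Additive.toMul (map_add (φ.hom.app (op V)).hom s t)

/-- The value of the image of a section at a geometric point. -/
def PushforwardHom.value (φ : PushforwardHom R K M) {V : (Spec (.of R)).Etale}
    (s : Sections R K M V) (q : GeomPoints K ((etalePullback (genericPt R K)).obj V)) : K̄ :=
  unitValue (q.1 ≫ etalePullbackFst (genericPt R K) V) (φ.hom.app (op V) s)

lemma PushforwardHom.value_eq (φ : PushforwardHom R K M) {V : (Spec (.of R)).Etale}
    (s : Sections R K M V) (q : GeomPoints K ((etalePullback (genericPt R K)).obj V)) :
    φ.value s q = functionValue (q.1 ≫ etalePullbackFst (genericPt R K) V) (φ.unit s).val := rfl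

lemma PushforwardHom.value_res (φ : PushforwardHom R K M) {V W : (Spec (.of R)).Etale} (f : V ⟶ W)
    (s : Sections R K M W) (q : GeomPoints K ((etalePullback (genericPt R K)).obj V)) :
    φ.value (s.res f) q = φ.value s (q.map ((etalePullback (genericPt R K)).map f)) := by
  rw [φ.value_eq, φ.value_eq, φ.unit_res, map_comp_fst, functionValue_comp _ f.left]

lemma PushforwardHom.value_add (φ : PushforwardHom R K M) {V : (Spec (.of R)).Etale}
    (s t : Sections R K M V) (q) : φ.value (s + t) q = φ.value s q * φ.value t q := by
  rw [φ.value_eq, φ.unit_add, Units.val_mul, map_mul]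
  rfl

lemma PushforwardHom.value_ne_zero (φ : PushforwardHom R K M) {V : (Spec (.of R)).Etale}
    (s : Sections R K M V) (q) : φ.value s q ≠ 0 :=
  ((φ.unit s).isUnit.map
    (functionValue (q.1 ≫ etalePullbackFst (genericPt R K) V))).ne_zero

lemma PushforwardHom.value_zero (φ : PushforwardHom R K M) {V : (Spec (.of R)).Etale}
    (q : GeomPoints K ((etalePullback (genericPt R K)).obj V)) :
    φ.value (0 : Sections R K M V) q = 1 := by
  have := φ.value_add 0 0 q
  rw [add_zero] at this
  exact (mul_eq_left₀ (φ.value_ne_zero _ q)).1 this.symm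

lemma PushforwardHom.value_smul (φ : PushforwardHom R K M) {V : (Spec (.of R)).Etale}
    (s : Sections R K M V) (σ : Gal(K̄/K)) (q) : φ.value s (σ • q) = σ (φ.value s q) := by
  rw [φ.value_eq, smul_comp_fst, functionValue_SpecMap_comp]
  rfl

lemma PushforwardHom.ext_value [FaithfulSMul R K] {φ ψ : PushforwardHom R K M}
    (h : ∀ (V : (Spec (.of R)).Etale) (s : Sections R K M V) q, φ.value s q = ψ.value s q) :
    φ = ψ := by
  have key : ∀ (V : (Spec (.of R)).Etale) (s : Sections R K M V), φ.unit s = ψ.unit s := by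
    intro V s
    refine Units.ext (functions_ext (K := K) V fun p hp => ?_)
    have := h V s (liftPt V p hp)
    rwa [φ.value_eq, ψ.value_eq, liftPt_fst] at this
  apply Sheaf.hom_ext
  apply NatTrans.ext
  funext V
  apply AddCommGrpCat.hom_ext
  apply AddMonoidHom.ext
  intro s
  exact congrArg Additive.ofMul (key V.unop s)

lemma PushforwardHom.add_value (φ ψ : PushforwardHom R K M) {V : (Spec (.of R)).Etale}
    (s : Sections R K M V) (q) : (φ + ψ).value s q = φ.value s q * ψ.value s q := by
  rw [value_eq, value_eq, value_eq, ← map_mul]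
  rfl

/-- Multiplicativity of `f` is not assumed: besides homomorphisms to `K̄`, the indicator function of
`0 ∈ M` is used. -/
lemma exists_function_of_section [FaithfulSMul R K] [PerfectField K] [IsIntegrallyClosedIn R K]
    (f : M → K̄) (hf : ∀ (σ : Gal(K̄/K)) m, f (σ • m) = σ (f m)) (hint : ∀ m, IsIntegral R (f m))
    {V : (Spec (.of R)).Etale} (s : Sections R K M V) :
    ∃ x : Γ(V.left, ⊤), ∀ p (hp : p ≫ structureHom V = geomPtOver R K),
      functionValue p x = f (s.1 (liftPt V p hp)) := by
  classical
  obtain ⟨x, hx⟩ := exists_function (R := R) (K := K) V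
    -- The default `0` concerns only morphisms not lying over the geometric generic point, where
    -- nothing is required.
    (fun p => if hp : p ≫ structureHom V = geomPtOver R K then f (s.1 (liftPt V p hp)) else 0)
    (fun σ p hp => by
      rw [dif_pos hp, dif_pos (SpecMap_gal_comp_structureHom V hp σ), liftPt_smul, s.2, hf])
    (fun p hp => by rw [dif_pos hp]; exact hint _)
  exact ⟨x, fun p hp => (hx p hp).trans (dif_pos hp)⟩

/-- An equivariant homomorphism from `M` to the integral units of `K̄` induces a homomorphism
from the direct image of the sheaf of `M` to `𝔾ₘ`. -/
lemma exists_pushforwardHom [FaithfulSMul R K] [PerfectField K] [IsIntegrallyClosedIn R K]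
    (f : Multiplicative M →* K̄)
    (hf : ∀ (σ : Gal(K̄/K)) (m : M), f (.ofAdd (σ • m)) = σ (f (.ofAdd m)))
    (hint : ∀ m, IsIntegral R (f m)) :
    ∃ φ : PushforwardHom R K M, ∀ (V : (Spec (.of R)).Etale) (s : Sections R K M V) q,
      φ.value s q = f (.ofAdd (s.1 q)) := by
  have h1 := fun (V : (Spec (.of R)).Etale) (s : Sections R K M V) =>
    exists_function_of_section (fun m => f (.ofAdd m)) hf (fun m => hint _) s
  choose x hx using h1
  have hmul : ∀ V (s t : Sections R K M V), x V (s + t) = x V s * x V t := fun V s t =>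
    functions_ext (K := K) V fun p hp => by
      rw [map_mul, hx V s p hp, hx V t p hp, hx V (s + t) p hp, ← map_mul]
      rfl
  have hone : ∀ V, x V 0 = 1 := fun V => functions_ext (K := K) V fun p hp => by
      rw [map_one, hx V 0 p hp, ← map_one f]
      rfl
  have hres : ∀ (V W : (Spec (.of R)).Etale) (g : V ⟶ W) (s : Sections R K M W),
      x V (s.res g) = g.left.appTop.hom (x W s) := fun V W g s =>
    functions_ext (K := K) V fun p hp => by
      rw [← functionValue_comp, hx V _ p hp, hx W s _ (comp_left_comp_structureHom g hp),
        ← map_liftPt]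
      rfl
  -- The inverse is the function attached to `-s`; thus integrality of `f` on all of `M` suffices to
  -- get units.
  let u (V) (s : Sections R K M V) : Γ(V.left, ⊤)ˣ :=
    ⟨x V s, x V (-s), by rw [← hmul, add_neg_cancel, hone], by rw [← hmul, neg_add_cancel, hone]⟩
  let φ : PushforwardHom R K M := ⟨
    { app V := AddCommGrpCat.ofHom
        { toFun s := Additive.ofMul (u V.unop s)
          map_zero' := congrArg Additive.ofMul (Units.ext (hone _))
          map_add' s t := congrArg Additive.ofMul (Units.ext (hmul _ s t)) }
      naturality V W g := by
        apply AddCommGrpCat.hom_ext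
        apply AddMonoidHom.ext
        intro s
        exact congrArg Additive.ofMul (Units.ext (hres _ _ g.unop s)) }⟩
  refine ⟨φ, fun V s q => ?_⟩
  have := hx V s _ (comp_fst_comp_structureHom V q)
  rw [liftPt_comp_fst] at this
  exact this

/-- The open subscheme where two sections agree. -/
lemma exists_res_eq [FaithfulSMul R K] [PerfectField K] [IsIntegrallyClosedIn R K]
    {V : (Spec (.of R)).Etale} (s t : Sections R K M V)
    (q : GeomPoints K ((etalePullback (genericPt R K)).obj V)) (h : s.1 q = t.1 q) :
    ∃ (W : (Spec (.of R)).Etale) (f : W ⟶ V)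
      (r : GeomPoints K ((etalePullback (genericPt R K)).obj W)),
      r.map ((etalePullback (genericPt R K)).map f) = q ∧ s.res f = t.res f := by
  classical
  -- The indicator of `0` is equivariant with integral values, so applied to `s - t` it is a regular
  -- function `x`; the sections agree on its basic open set.
  obtain ⟨x, hx⟩ := exists_function_of_section (R := R) (K := K)
    (fun m : M => if m = 0 then (1 : K̄) else 0)
    (fun σ m => by simp only [smul_eq_zero_iff_eq]; split_ifs <;> simp)
    (fun m => by split_ifs; exacts [isIntegral_one, isIntegral_zero]) (s - t)
  let W := V.left.basicOpen x
  let p := q.1 ≫ etalePullbackFst (genericPt R K) V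
  have hp := comp_fst_comp_structureHom V q
  have hpx : functionValue p x = 1 := by
    rw [hx p hp, liftPt_comp_fst, if_pos]
    exact sub_eq_zero.2 h
  have hrange : Set.range p ⊆ Set.range W.ι := by
    have h1 : p.appTop.hom x = 1 := by
      apply (Scheme.ΓSpecIso (.of K̄)).commRingCatIsoToRingEquiv.injective
      exact hpx.trans (map_one _).symm
    have h2 : p ⁻¹ᵁ W = ⊤ := by
      rw [Scheme.preimage_basicOpen_top]
      exact (congrArg _ h1).trans (Scheme.basicOpen_of_isUnit _ isUnit_one)
    rw [Scheme.Opens.range_ι]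
    rintro _ ⟨z, rfl⟩
    exact h2.ge (Set.mem_univ z)
  let p' : Spec (.of K̄) ⟶ (W : Scheme.{u}) := IsOpenImmersion.lift W.ι p hrange
  have hp' : p' ≫ W.ι = p := IsOpenImmersion.lift_fac _ _ _
  have hp2 : p' ≫ structureHom (openObj V W.ι) = geomPtOver R K := by
    rw [← hp]
    exact (Category.assoc _ _ _).symm.trans (congrArg (· ≫ structureHom V) hp')
  refine ⟨openObj V W.ι, openObjHom V W.ι, liftPt _ p' hp2, ?_, ?_⟩
  · refine (map_liftPt (openObjHom V W.ι) hp2).trans (geomPoints_pullback_ext V ?_)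
    exact (liftPt_fst V _ _).trans hp'
  · refine Subtype.ext (funext fun r => ?_)
    have h2 : functionValue ((r.map ((etalePullback (genericPt R K)).map
        (openObjHom V W.ι))).1 ≫ etalePullbackFst (genericPt R K) V) x ≠ 0 := by
      rw [map_comp_fst, functionValue_comp _ (openObjHom V W.ι).left]
      have : IsUnit (W.ι.appTop.hom x) := by
        have h3 : W.ι.appTop = V.left.presheaf.map (homOfLE (le_top : W ≤ ⊤)).op ≫
            W.ι.appLE W ⊤ W.ι_preimage_self.ge := by
          rw [Scheme.Hom.map_appLE, Scheme.Hom.appTop, Scheme.Hom.app_eq_appLE]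
          rfl
        rw [h3]
        exact (V.left.toRingedSpace.isUnit_res_basicOpen x).map
          (W.ι.appLE W ⊤ W.ι_preimage_self.ge).hom
      exact (this.map (functionValue (r.1 ≫ etalePullbackFst (genericPt R K)
        (openObj V W.ι)))).ne_zero
    rw [hx _ (comp_fst_comp_structureHom V _), liftPt_comp_fst] at h2
    by_contra h3
    refine h2 (if_neg fun h4 => h3 ?_)
    exact sub_eq_zero.1 h4

/-- The étale neighbourhoods of a fixed geometric point form a cofiltered category. -/
lemma exists_common_refinement {V W : (Spec (.of R)).Etale}
    (q : GeomPoints K ((etalePullback (genericPt R K)).obj V))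
    (r : GeomPoints K ((etalePullback (genericPt R K)).obj W)) :
    ∃ (Z : (Spec (.of R)).Etale) (f : Z ⟶ V) (g : Z ⟶ W)
      (t : GeomPoints K ((etalePullback (genericPt R K)).obj Z)),
      t.map ((etalePullback (genericPt R K)).map f) = q ∧
      t.map ((etalePullback (genericPt R K)).map g) = r := by
  let F := Scheme.Etale.forget (Spec (.of R)) ⋙ coyoneda.obj (op (Over.mk (geomPtOver R K)))
  let e {T : (Spec (.of R)).Etale} (p : GeomPoints K ((etalePullback (genericPt R K)).obj T)) :
    F.Elements := F.elementsMk T (Over.homMk (p.1 ≫ etalePullbackFst (genericPt R K) T)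
      (comp_fst_comp_structureHom T p))
  obtain ⟨z, g, g', -⟩ := IsCofilteredOrEmpty.cone_objs (e q) (e r)
  refine ⟨z.1, g.1, g'.1, liftPt z.1 z.2.left (CategoryTheory.Over.w z.2), ?_, ?_⟩
  · refine (map_liftPt g.1 (CategoryTheory.Over.w z.2)).trans (geomPoints_pullback_ext V ?_)
    exact (liftPt_fst V _ _).trans (congrArg CommaMorphism.left g.2)
  · refine (map_liftPt g'.1 (CategoryTheory.Over.w z.2)).trans (geomPoints_pullback_ext W ?_)
    exact (liftPt_fst W _ _).trans (congrArg CommaMorphism.left g'.2)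

/-- This makes the stalk map well defined: restrict to a common neighbourhood, then shrink it until
the two sections coincide. -/
lemma PushforwardHom.value_eq_value [FaithfulSMul R K] [PerfectField K] [IsIntegrallyClosedIn R K]
    (φ : PushforwardHom R K M) {V W : (Spec (.of R)).Etale} (s : Sections R K M V)
    (t : Sections R K M W) (q) (r) (h : s.1 q = t.1 r) : φ.value s q = φ.value t r := by
  obtain ⟨Z, f, g, z, rfl, rfl⟩ := exists_common_refinement q r
  obtain ⟨Z', f', z', rfl, h'⟩ := exists_res_eq (s.res f) (t.res g) z h
  rw [← φ.value_res, ← φ.value_res, ← φ.value_res, ← φ.value_res, h']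

/-- A homomorphism from the direct image of the sheaf of `M` to `𝔾ₘ` comes from an equivariant
homomorphism `M → K̄ˣ`, its stalk at the geometric generic point. -/
lemma PushforwardHom.exists_stalk [FaithfulSMul R K] [PerfectField K] [IsIntegrallyClosedIn R K]
    (hM : ∀ m : M, ∃ (V : (Spec (.of R)).Etale) (s : Sections R K M V)
      (q : GeomPoints K ((etalePullback (genericPt R K)).obj V)), s.1 q = m)
    (φ : PushforwardHom R K M) :
    ∃ f : Multiplicative M →* K̄,
      (∀ (σ : Gal(K̄/K)) (m : M), f (.ofAdd (σ • m)) = σ (f (.ofAdd m))) ∧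
      ∀ (V : (Spec (.of R)).Etale) (s : Sections R K M V) q,
        φ.value s q = f (.ofAdd (s.1 q)) := by
  choose V s q hq using hM
  let g (m : M) : K̄ := φ.value (s m) (q m)
  have hg : ∀ (V : (Spec (.of R)).Etale) (s : Sections R K M V) q, φ.value s q = g (s.1 q) :=
    fun V s q => φ.value_eq_value _ _ _ _ (hq _).symm
  refine ⟨{ toFun m := g m.toAdd, map_one' := ?_, map_mul' m n := ?_ }, fun σ m => ?_, hg⟩
  · exact (hg (V 0) 0 (q 0)).symm.trans (φ.value_zero _)
  · obtain ⟨Z, f, f', z, h1, h2⟩ := exists_common_refinement (q m.toAdd) (q n.toAdd)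
    have h3 := hg Z ((s m.toAdd).res f + (s n.toAdd).res f') z
    rw [φ.value_add, φ.value_res, φ.value_res, h1, h2] at h3
    refine Eq.trans ?_ h3.symm
    have : ((s m.toAdd).res f + (s n.toAdd).res f').1 z = m.toAdd + n.toAdd := by
      have h4 := hq m.toAdd
      have h5 := hq n.toAdd
      rw [← h1] at h4
      rw [← h2] at h5
      exact congrArg₂ (· + ·) h4 h5
    rw [this]
    rfl
  · have := hg _ (s m) (σ • q m)
    rw [φ.value_smul, (s m).2, hq] at this
    exact this.symm

end Pushforward

/-! ### Galois orbits of characters -/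

section Finiteness

variable {K A k Ω : Type u} [Field K] [CommRing A] [HopfAlgebra K A] [Field k] [Algebra K k]
  [Field Ω] [Algebra K Ω] [Algebra k Ω] [IsScalarTower K k Ω]

/-- A tensor involves finitely many scalars, each with finitely many conjugates. -/
lemma finite_range_baseMap [Algebra.IsAlgebraic k Ω] (z : Ω ⊗[K] A) :
    (Set.range fun σ : Gal(Ω/k) => baseMap A (σ.restrictScalars K : Ω →ₐ[K] Ω) z).Finite := by
  induction z with
  | zero => exact (Set.finite_singleton 0).subset (by rintro _ ⟨σ, rfl⟩; simp)
  | add a b ha hb =>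
    refine (Set.Finite.image2 (· + ·) ha hb).subset ?_
    rintro _ ⟨σ, rfl⟩
    exact ⟨_, ⟨σ, rfl⟩, _, ⟨σ, rfl⟩, (map_add _ _ _).symm⟩
  | tmul a b =>
    have : (Set.range fun σ : Gal(Ω/k) => σ a).Finite := by
      refine ((minpoly k a).rootSet_finite Ω).subset ?_
      rintro _ ⟨σ, rfl⟩
      rw [Polynomial.mem_rootSet]
      refine ⟨minpoly.ne_zero (Algebra.IsIntegral.isIntegral a), ?_⟩
      change Polynomial.aeval (σ a) (minpoly k a) = 0
      rw [← AlgEquiv.coe_toAlgHom, Polynomial.aeval_algHom_apply, minpoly.aeval, map_zero]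
    refine (this.image fun c => c ⊗ₜ[K] b).subset ?_
    rintro _ ⟨σ, rfl⟩
    exact ⟨σ a, ⟨σ, rfl⟩, rfl⟩

lemma Characters.finite_orbit [Algebra.IsAlgebraic k Ω] (χ : Characters K A Ω) :
    (Set.range fun σ : Gal(Ω/k) => σ.restrictScalars K • χ).Finite :=
  Set.Finite.of_finite_image ((finite_range_baseMap (k := k) χ.val).subset
    (by rintro _ ⟨_, ⟨σ, rfl⟩, rfl⟩; exact ⟨σ, rfl⟩))
    (f := GroupLike.val) fun _ _ _ _ h => GroupLike.ext h

/-- Every element of `Ω ⊗[K] A` is fixed by the Galois group over a finite extension of `K`. -/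
lemma exists_finiteDimensional_baseMap_eq [Algebra.IsAlgebraic K Ω] (z : Ω ⊗[K] A) :
    ∃ E : IntermediateField K Ω, FiniteDimensional K E ∧
      ∀ σ ∈ E.fixingSubgroup, baseMap A (σ : Ω →ₐ[K] Ω) z = z := by
  induction z with
  | zero => exact ⟨⊥, inferInstance, fun σ _ => by simp⟩
  | add a b ha hb =>
    obtain ⟨E, hE, ha⟩ := ha
    obtain ⟨F, hF, hb⟩ := hb
    refine ⟨E ⊔ F, IntermediateField.finiteDimensional_sup E F, fun σ hσ => ?_⟩
    rw [map_add, ha σ (IntermediateField.fixingSubgroup_le le_sup_left hσ),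
      hb σ (IntermediateField.fixingSubgroup_le le_sup_right hσ)]
  | tmul a b =>
    refine ⟨IntermediateField.adjoin K {a}, IntermediateField.adjoin.finiteDimensional
      (Algebra.IsIntegral.isIntegral a), fun σ hσ => ?_⟩
    have : σ a = a := hσ ⟨a, IntermediateField.mem_adjoin_simple_self K a⟩
    simp [baseMap, this]

lemma Characters.isOpen_stabilizer [Algebra.IsAlgebraic K Ω] (χ : Characters K A Ω) :
    IsOpen (MulAction.stabilizer Gal(Ω/K) χ : Set Gal(Ω/K)) := by
  obtain ⟨E, hE, h⟩ := exists_finiteDimensional_baseMap_eq χ.val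
  refine Subgroup.isOpen_mono (H₁ := E.fixingSubgroup) (fun σ hσ => ?_)
    (IntermediateField.fixingSubgroup_isOpen E)
  exact GroupLike.ext (h σ hσ)

/-- The values of characters at a fixed point, as a homomorphism. -/
def Characters.evalHom {L : Type u} [Field L] [Algebra K L] (x : Points K A L) :
    Characters K A L →* L :=
  (x.baseChange : L ⊗[K] A →* L).comp (GroupLike.valMonoidHom L (L ⊗[K] A))

lemma Characters.evalHom_apply {L : Type u} [Field L] [Algebra K L] (x : Points K A L)
    (χ : Characters K A L) : Characters.evalHom x χ = χ.eval x := rfl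

/-- The product of the conjugates of a character over `Ω` is defined over the base field. -/
lemma Characters.exists_map_eq_prod [IsGalois k Ω] (χ : Characters K A Ω) :
    ∃ (s : Finset (Characters K A Ω)) (ψ : Characters K A k),
      χ ∈ s ∧ (∀ ξ ∈ s, ∃ σ : Gal(Ω/k), ξ = σ.restrictScalars K • χ) ∧
      ψ.map (IsScalarTower.toAlgHom K k Ω) = ∏ ξ ∈ s, ξ := by
  classical
  let s := (Characters.finite_orbit (k := k) χ).toFinset
  have hs : ∀ ξ, ξ ∈ s ↔ ∃ σ : Gal(Ω/k), σ.restrictScalars K • χ = ξ := fun ξ => by simp [s]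
  -- The product runs over the finite orbit, not over the possibly infinite group; `σ` permutes the
  -- orbit.
  obtain ⟨ψ, hψ⟩ := Characters.exists_map_eq_of_invariant (k := k) (∏ ξ ∈ s, ξ) fun σ => by
    rw [Finset.smul_prod']
    refine Finset.prod_nbij (σ.restrictScalars K • ·) (fun ξ hξ => ?_) (fun ξ _ ξ' _ h => ?_)
      (fun ξ hξ => ?_) (fun _ _ => rfl)
    · obtain ⟨τ, rfl⟩ := (hs ξ).1 hξ
      exact (hs _).2 ⟨σ * τ, mul_smul (σ.restrictScalars K) (τ.restrictScalars K) χ⟩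
    · exact MulAction.injective (σ.restrictScalars K) h
    · obtain ⟨τ, rfl⟩ := (hs ξ).1 hξ
      refine ⟨(σ⁻¹ * τ).restrictScalars K • χ, (hs _).2 ⟨_, rfl⟩, ?_⟩
      refine (mul_smul (σ.restrictScalars K) ((σ⁻¹ * τ).restrictScalars K) χ).symm.trans ?_
      congr 1
      ext y
      simp
  refine ⟨s, ψ, (hs _).2 ⟨1, one_smul _ _⟩, fun ξ hξ => ?_, hψ⟩
  obtain ⟨σ, rfl⟩ := (hs ξ).1 hξ
  exact ⟨σ, rfl⟩

end Finiteness

/-! ### Absolute values of character values over a complete field -/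

section SpectralNorm

variable {k Ω : Type u} [NontriviallyNormedField k] [CompleteSpace k] [IsUltrametricDist k]
  [Field Ω] [Algebra k Ω] [Algebra.IsAlgebraic k Ω]

/-- A character over `Ω` has absolute value one at a `K`-point at which all characters
over the complete field `k` have absolute value one. -/
lemma Characters.spectralNorm_eval_eq_one {K A : Type u} [Field K] [CommRing A] [HopfAlgebra K A]
    [Algebra K k] [Algebra K Ω] [IsScalarTower K k Ω] [IsGalois k Ω] (x : Points K A K)
    (hx : ∀ ψ : Characters K A k, ‖ψ.eval (Points.map (Algebra.ofId K k) x)‖ = 1)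
    (χ : Characters K A Ω) :
    spectralNorm k Ω (χ.eval (Points.map (Algebra.ofId K Ω) x)) = 1 := by
  obtain ⟨s, ψ, hχ, hs, hψ⟩ := Characters.exists_map_eq_prod (k := k) χ
  have h1 := congrArg (fun ξ => spectralNorm k Ω
    (Characters.evalHom (Points.map (Algebra.ofId K Ω) x) ξ)) hψ
  simp only [map_prod] at h1
  rw [Characters.evalHom_apply, Characters.eval_map_ofId, IsScalarTower.toAlgHom_apply,
    spectralNorm_extends, hx ψ] at h1
  -- Conjugate factors have equal spectral norm, so a positive power of the norm sought is one.
  rw [← spectralMulAlgNorm_def, map_prod, Finset.prod_congr rfl (g := fun _ =>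
    spectralNorm k Ω (χ.eval (Points.map (Algebra.ofId K Ω) x))), Finset.prod_const] at h1
  · exact (pow_eq_one_iff_of_nonneg (spectralNorm_nonneg _)
      (Finset.card_ne_zero_of_mem hχ)).1 h1.symm
  · intro ξ hξ
    obtain ⟨σ, rfl⟩ := hs ξ hξ
    rw [Characters.evalHom_apply, Characters.eval_smul_ofId, spectralMulAlgNorm_def]
    exact (spectralNorm_eq_of_equiv σ _).symm

variable (k Ω) in
/-- The valuation ring of the spectral norm. -/
def spectralUnitBall : Subring Ω where
  carrier := {y | spectralNorm k Ω y ≤ 1}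
  mul_mem' {a b} ha hb := by
    have := map_mul (spectralMulAlgNorm k Ω) a b
    simp only [spectralMulAlgNorm_def] at this
    exact this.trans_le (mul_le_one₀ ha (spectralNorm_nonneg _) hb)
  one_mem' := spectralNorm_one.le
  add_mem' {a b} ha hb := (isNonarchimedean_spectralNorm a b).trans (max_le ha hb)
  zero_mem' := spectralNorm_zero.trans_le zero_le_one
  neg_mem' {a} ha := (spectralNorm_neg (Algebra.IsAlgebraic.isAlgebraic a)).trans_le ha

end SpectralNorm

lemma coeff_mem_of_roots_mem {Ω : Type*} [Field Ω] {p : Polynomial Ω} (hp : p.Monic)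
    (hs : p.Splits) (R : Subring Ω) (h : ∀ a ∈ p.roots, a ∈ R) (n : ℕ) : p.coeff n ∈ R := by
  have : p ∈ Polynomial.lifts R.subtype := by
    rw [hs.eq_prod_roots_of_monic hp]
    refine multiset_prod_mem _ fun q hq => ?_
    obtain ⟨a, ha, rfl⟩ := Multiset.mem_map.1 hq
    exact ⟨Polynomial.X - Polynomial.C ⟨a, h a ha⟩, by simp⟩
  obtain ⟨c, hc⟩ := (Polynomial.lifts_iff_coeff_lifts _).1 this n
  exact hc ▸ c.2

/-- The minimal polynomial over `K` of the value of a character at a `K`-point has coefficients of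
absolute value at most one if all characters over the complete field `k` have absolute value one
at that point. -/
lemma Characters.norm_coeff_minpoly_eval_le_one {K A k : Type u} [Field K] [CommRing A]
    [HopfAlgebra K A] [NontriviallyNormedField k] [CompleteSpace k] [IsUltrametricDist k]
    [CharZero k] [Algebra K k] (x : Points K A K)
    (hx : ∀ ψ : Characters K A k, ‖ψ.eval (Points.map (Algebra.ofId K k) x)‖ = 1)
    (χ : Characters K A (AlgebraicClosure K)) (n : ℕ) :
    ‖algebraMap K k ((minpoly K
      (χ.eval (Points.map (Algebra.ofId K (AlgebraicClosure K)) x))).coeff n)‖ ≤ 1 := by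
  let Ω := AlgebraicClosure k
  set y := χ.eval (Points.map (Algebra.ofId K (AlgebraicClosure K)) x) with hy'
  have hy : IsIntegral K y := Algebra.IsIntegral.isIntegral y
  have h1 := coeff_mem_of_roots_mem ((minpoly.monic hy).map (algebraMap K Ω))
    (IsAlgClosed.splits _) (spectralUnitBall k Ω) (fun a ha => ?_) n
  · rw [Polynomial.coeff_map, IsScalarTower.algebraMap_apply K k Ω] at h1
    have h2 : spectralNorm k Ω _ ≤ 1 := h1
    rwa [spectralNorm_extends] at h2
  · rw [Polynomial.mem_roots_map_of_injective (algebraMap K Ω).injective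
      (minpoly.ne_zero hy)] at ha
    -- Every root in `Ω` is the image of `y` under an embedding `ι` of `K̄`, hence the value at `x`
    -- of the character `χ.map ι`.
    obtain ⟨ι, rfl⟩ := (Algebra.IsAlgebraic.range_eval_eq_rootSet_minpoly (F := K)
      (K := AlgebraicClosure K) Ω y).ge (Polynomial.mem_rootSet.2 ⟨minpoly.ne_zero hy, ha⟩)
    have := Characters.spectralNorm_eval_eq_one (Ω := Ω) x hx (χ.map ι)
    rw [Characters.eval_map_ofId] at this
    exact this.le

/-! ### Integrality of character values at `S`-units -/

section NumberField

variable {K : Type u} [Field K] [NumberField K]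

/-- The ring of `S`-integers is an intersection of valuation rings, each integrally closed in `K`.
-/
instance (S : Set (HeightOneSpectrum (𝓞 K))) : IsIntegrallyClosedIn (S.integer K) K := by
  rw [isIntegrallyClosedIn_iff]
  refine ⟨Subtype.val_injective, fun {x} hx => ⟨⟨x, fun v hv => ?_⟩, rfl⟩⟩
  refine (Valuation.integer.integers (v.valuation K)).mem_of_integral ?_
  let g : S.integer K →+* (v.valuation K).integer :=
    (algebraMap (S.integer K) K).codRestrict _ fun y => y.2 v hv
  obtain ⟨p, hp, h⟩ := hx
  exact ⟨p.map g, hp.map g, by rwa [Polynomial.eval₂_map]⟩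

instance (v : HeightOneSpectrum (𝓞 K)) : CharZero (v.adicCompletion K) :=
  charZero_of_injective_algebraMap (algebraMap K (v.adicCompletion K)).injective

lemma valuation_coeff_minpoly_eval_le_one {A : Type u} [CommRing A] [HopfAlgebra K A]
    (v : HeightOneSpectrum (𝓞 K)) (x : Points K A K)
    (hx : ∀ ψ : Characters K A (v.adicCompletion K),
      Valued.v (ψ.eval (Points.map (Algebra.ofId K (v.adicCompletion K)) x)) = 1)
    (χ : Characters K A (AlgebraicClosure K)) (n : ℕ) :
    v.valuation K ((minpoly K
      (χ.eval (Points.map (Algebra.ofId K (AlgebraicClosure K)) x))).coeff n) ≤ 1 := by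
  let : NontriviallyNormedField (v.adicCompletion K) := Valued.toNontriviallyNormedField _ _
  have : CompleteSpace (v.adicCompletion K) :=
    inferInstanceAs (@CompleteSpace (v.adicCompletion K)
      (HeightOneSpectrum.adicCompletion.instUniformSpace K v))
  have : IsUltrametricDist (v.adicCompletion K) :=
    inferInstanceAs (@IsUltrametricDist (v.adicCompletion K)
      (Valued.toNormedField _ _).toDist)
  rw [← HeightOneSpectrum.valuedAdicCompletion_eq_valuation']
  refine Valued.toNormedField.norm_le_one_iff.1
    (Characters.norm_coeff_minpoly_eval_le_one x (fun ψ => ?_) χ n)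
  exact le_antisymm (Valued.toNormedField.norm_le_one_iff.2 (hx ψ).le)
    (Valued.toNormedField.one_le_norm_iff.2 (hx ψ).ge)

/-- The minimal polynomial of the value is `v`-integral for every `v ∉ S`, so it is a monic
polynomial over the `S`-integers. -/
theorem isIntegral_eval_of_mem_sUnits {A : Type u} [CommRing A] [HopfAlgebra K A]
    {S : Set (HeightOneSpectrum (𝓞 K))} {x : Points K A K} (hx : x ∈ sUnits K A S)
    (χ : Characters K A (AlgebraicClosure K)) :
    IsIntegral (S.integer K)
      (χ.eval (Points.map (Algebra.ofId K (AlgebraicClosure K)) x)) := by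
  set y := χ.eval (Points.map (Algebra.ofId K (AlgebraicClosure K)) x)
  have hy : IsIntegral K y := Algebra.IsIntegral.isIntegral y
  have hc : minpoly K y ∈ Polynomial.lifts (algebraMap (S.integer K) K) := by
    rw [Polynomial.lifts_iff_coeff_lifts]
    refine fun n => ⟨⟨(minpoly K y).coeff n, fun v hv => ?_⟩, rfl⟩
    refine valuation_coeff_minpoly_eval_le_one v x (fun ψ => ?_) χ n
    simp only [sUnits, Subgroup.mem_iInf] at hx
    exact hx v hv ψ
  obtain ⟨q, hq, -, hqm⟩ := Polynomial.lifts_and_degree_eq_and_monic hc (minpoly.monic hy)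
  refine ⟨q, hqm, ?_⟩
  have := minpoly.aeval K y
  rw [← hq] at this
  rwa [← Polynomial.aeval_def, ← Polynomial.aeval_map_algebraMap K]

end NumberField

/-! ### Sections over étale algebras with a single Galois orbit of points -/

section Orbit

variable {R K : Type u} [CommRing R] [Field K] [Algebra R K]
  {M : Type u} [AddCommGroup M] [DistribMulAction Gal(AlgebraicClosure K/K) M]

lemma exists_unit_functionValue {B Ω : Type u} [CommRing B] [Field Ω] (ψ : B →+* Ω)
    (g : Γ(Spec (.of B), ⊤)ˣ) :
    ∃ b : Bˣ, functionValue (Spec.map (CommRingCat.ofHom ψ)) g.val = ψ b := by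
  have h : IsUnit (M := B) ((Scheme.ΓSpecIso (.of B)).hom.hom g.val) :=
    RingHom.isUnit_map (Scheme.ΓSpecIso (.of B)).hom.hom g.isUnit
  obtain ⟨b, hb⟩ := h
  exact ⟨b, hb ▸ functionValue_SpecMap (B := .of B) ψ g.val⟩

/-- If the geometric points of an étale algebra `B` form a single Galois orbit, then an element
of a Galois module fixed by the stabilizer of a geometric point is the value at that point of
a section over `Spec B`. -/
lemma exists_section_of_orbit {B : Type u} [CommRing B] [Algebra R B] [Algebra.Etale R B]
    (i : B →ₐ[R] AlgebraicClosure K) (m : M)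
    (h1 : ∀ p : B →ₐ[R] AlgebraicClosure K, ∃ σ : Gal(AlgebraicClosure K/K),
      ∀ b, p b = σ (i b))
    (h2 : ∀ σ : Gal(AlgebraicClosure K/K), (∀ b, σ (i b) = i b) → σ • m = m) :
    ∃ (V : (Spec (.of R)).Etale) (s : Sections R K M V)
      (q : GeomPoints K ((etalePullback (genericPt R K)).obj V)), s.1 q = m ∧
      ∀ φ : PushforwardHom R K M, ∃ b : Bˣ, φ.value s q = i b := by
  have : Etale (Spec.map (CommRingCat.ofHom (algebraMap R B))) :=
    (HasRingHomProperty.Spec_iff (P := @Etale)).2 (RingHom.etale_algebraMap.2 ‹_›)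
  let V : (Spec (.of R)).Etale := Scheme.Etale.mk (Spec.map (CommRingCat.ofHom (algebraMap R B)))
  have hp : ∀ q : GeomPoints K ((etalePullback (genericPt R K)).obj V),
      ∃ σ : Gal(AlgebraicClosure K/K), q.1 ≫ etalePullbackFst (genericPt R K) V =
        Spec.map (CommRingCat.ofHom ((σ : AlgebraicClosure K →+* AlgebraicClosure K).comp
          i.toRingHom)) := by
    intro q
    obtain ⟨ψ, hψ⟩ := Spec.map_surjective (show Spec (.of (AlgebraicClosure K)) ⟶ Spec (.of B) from
      q.1 ≫ etalePullbackFst (genericPt R K) V)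
    have h : Spec.map ψ ≫ Spec.map (CommRingCat.ofHom (algebraMap R B)) = geomPtOver R K := by
      rw [hψ]; exact comp_fst_comp_structureHom V q
    obtain ⟨σ, hσ⟩ := h1 ⟨ψ.hom, fun r => DFunLike.congr_fun
      ((SpecMap_comp_eq_geomPtOver_iff ψ.hom).1 h) r⟩
    refine ⟨σ, hψ.symm.trans ?_⟩
    congr 1
    ext b
    exact hσ b
  -- Each geometric point is `g q ∘ i`; the section takes the value `g q • m` there. By `h2` this
  -- does not depend on the choice of `g q`.
  choose g hg using hp
  have key : ∀ (q : GeomPoints K ((etalePullback (genericPt R K)).obj V))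
      (σ : Gal(AlgebraicClosure K/K)), q.1 ≫ etalePullbackFst (genericPt R K) V =
        Spec.map (CommRingCat.ofHom ((σ : AlgebraicClosure K →+* AlgebraicClosure K).comp
          i.toRingHom)) → g q • m = σ • m := by
    intro q σ hσ
    have h := congrArg CommRingCat.Hom.hom (Spec.map_injective ((hg q).symm.trans hσ))
    rw [eq_comm, ← inv_smul_eq_iff, ← mul_smul]
    refine h2 _ fun b => ?_
    have h3 : g q (i b) = σ (i b) := DFunLike.congr_fun h b
    rw [AlgEquiv.mul_apply, ← h3]
    exact (g q).symm_apply_apply _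
  let s : Sections R K M V := ⟨fun q => g q • m, fun σ q => by
    rw [← mul_smul]
    refine key _ _ ?_
    rw [smul_comp_fst, hg q]
    exact (Spec.map_comp _ _).symm⟩
  have hq : (show Spec (.of (AlgebraicClosure K)) ⟶ V.left from
      Spec.map (CommRingCat.ofHom i.toRingHom)) ≫ structureHom V = geomPtOver R K :=
    (SpecMap_comp_eq_geomPtOver_iff _).2 i.comp_algebraMap
  refine ⟨V, s, liftPt V _ hq, ?_, fun φ => ?_⟩
  · refine (key _ 1 ?_).trans (one_smul _ m)
    rw [liftPt_fst]
    rfl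
  · rw [φ.value_eq, liftPt_fst]
    exact exists_unit_functionValue i.toRingHom (φ.unit s)

end Orbit

/-! ### Étale neighbourhoods of unramified primes -/

section Localization

variable {K : Type u} [Field K] [NumberField K] {L : Type u} [Field L] [NumberField L]
  [Algebra K L]

/-- The kernel of `p` meets `𝓞 K` trivially, hence is zero by integrality of `𝓞 L`, and `p` extends
to fractions. -/
lemma exists_algHom_eq_on_integers {E : Type u} [Field E] [Algebra K E]
    (p : 𝓞 L →ₐ[𝓞 K] E) : ∃ q : L →ₐ[K] E, ∀ x : 𝓞 L, q x = p x := by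
  have hinj : Function.Injective p := by
    rw [← AlgHom.coe_toRingHom, RingHom.injective_iff_ker_eq_bot]
    refine Ideal.eq_bot_of_comap_eq_bot (R := 𝓞 K) ?_
    rw [RingHom.comap_ker, ← RingHom.injective_iff_ker_eq_bot, p.comp_algebraMap,
      IsScalarTower.algebraMap_eq (𝓞 K) K E]
    exact (algebraMap K E).injective.comp (FaithfulSMul.algebraMap_injective _ _)
  let q : L →+* E := IsFractionRing.lift (A := 𝓞 L) (g := p.toRingHom) hinj
  have hq : ∀ x : 𝓞 L, q x = p x := fun x => IsFractionRing.lift_algebraMap hinj x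
  have : q.comp (algebraMap K L) = algebraMap K E := by
    refine IsLocalization.ringHom_ext (nonZeroDivisors (𝓞 K)) (RingHom.ext fun x => ?_)
    have := hq (algebraMap (𝓞 K) (𝓞 L) x)
    rw [p.commutes] at this
    exact this
  exact ⟨⟨q, fun r => DFunLike.congr_fun this r⟩, hq⟩

variable {M : Type u} [AddCommGroup M] [DistribMulAction Gal(AlgebraicClosure K/K) M]

/-- An element `m` of a Galois module fixed by the Galois group over `L` is the value of a section
over an étale neighbourhood of each prime of `L` unramified over `K`; the units on this
neighbourhood lie in all rings containing the local ring. -/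
lemma exists_section_of_isUnramifiedAt (S : Set (HeightOneSpectrum (𝓞 K)))
    (l : L →ₐ[K] AlgebraicClosure K) (m : M)
    (hm : ∀ σ : Gal(AlgebraicClosure K/K), (∀ x, σ (l x) = l x) → σ • m = m)
    (q : Ideal (𝓞 L)) [q.IsPrime] [Algebra.IsUnramifiedAt (𝓞 K) q] :
    ∃ (V : (Spec (.of (S.integer K))).Etale) (s : Sections (S.integer K) K M V)
      (z : GeomPoints K ((etalePullback (genericPt (S.integer K) K)).obj V)), s.1 z = m ∧
      ∀ (φ : PushforwardHom (S.integer K) K M) (O : Subring (AlgebraicClosure K)),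
        (∀ r : S.integer K, algebraMap _ (AlgebraicClosure K) r ∈ O) →
        (∀ x : 𝓞 L, l x ∈ O) → (∀ x : 𝓞 L, x ∉ q → (l x)⁻¹ ∈ O) →
        φ.value s z ∈ O ∧ (φ.value s z)⁻¹ ∈ O := by
  have : Algebra.FinitePresentation (𝓞 K) (𝓞 L) :=
    Algebra.FinitePresentation.of_finiteType.1 inferInstance
  have := Algebra.IsEtaleAt.of_isUnramifiedAt_of_flat (R := 𝓞 K) q
  -- Flat and unramified at `q` means étale at `q`, hence étale after inverting some `a ∉ q`. The
  -- neighbourhood used is the spectrum of `S.integer K ⊗[𝓞 K] C`.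
  obtain ⟨a, haq, hC⟩ := Algebra.exists_etale_of_isEtaleAt (R := 𝓞 K) q
  let C := Localization.Away a
  let l₀ : 𝓞 L →ₐ[𝓞 K] AlgebraicClosure K :=
    (l.restrictScalars (𝓞 K)).comp (IsScalarTower.toAlgHom (𝓞 K) (𝓞 L) L)
  have ha : l a ≠ 0 := by
    rw [map_ne_zero]
    exact fun h => haq ((NumberField.RingOfIntegers.coe_eq_zero_iff.1 h) ▸ q.zero_mem)
  have hunit : ∀ y : Submonoid.powers a, IsUnit (l₀ y) := by
    rintro ⟨_, n, rfl⟩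
    exact (map_pow l₀ a n) ▸ (IsUnit.mk0 _ ha).pow n
  let lC : C →ₐ[𝓞 K] AlgebraicClosure K := IsLocalization.liftAlgHom (f := l₀) hunit
  have hlC : ∀ x : 𝓞 L, lC (algebraMap _ C x) = l x := fun x => IsLocalization.lift_eq _ x
  let i : S.integer K ⊗[𝓞 K] C →ₐ[S.integer K] AlgebraicClosure K :=
    Algebra.TensorProduct.lift (Algebra.ofId _ _) lC fun _ _ => Commute.all _ _
  have hi : ∀ r c, i (r ⊗ₜ c) = algebraMap _ (AlgebraicClosure K) r * lC c := fun r c => rfl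
  have ext : ∀ p p' : S.integer K ⊗[𝓞 K] C →ₐ[S.integer K] AlgebraicClosure K,
      (∀ x : 𝓞 L, p (1 ⊗ₜ algebraMap _ C x) = p' (1 ⊗ₜ algebraMap _ C x)) → p = p' := by
    intro p p' h
    refine Algebra.TensorProduct.ext (by ext) ?_
    refine IsLocalization.algHom_ext (Submonoid.powers a) (AlgHom.ext fun x => ?_)
    exact h x
  -- A geometric point amounts to an embedding of `L`, and any two of these are conjugate.
  have h1 : ∀ p : S.integer K ⊗[𝓞 K] C →ₐ[S.integer K] AlgebraicClosure K,
      ∃ σ : Gal(AlgebraicClosure K/K), ∀ b, p b = σ (i b) := by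
    intro p
    let p₀ : 𝓞 L →ₐ[𝓞 K] AlgebraicClosure K :=
      ((p.restrictScalars (𝓞 K)).comp Algebra.TensorProduct.includeRight).comp
        (IsScalarTower.toAlgHom (𝓞 K) (𝓞 L) C)
    obtain ⟨p₁, hp₁⟩ := exists_algHom_eq_on_integers p₀
    obtain ⟨σ, hσ⟩ := exists_gal_apply_eq l p₁
    have := ext p (((σ : AlgebraicClosure K →ₐ[K] AlgebraicClosure K).restrictScalars
      (S.integer K)).comp i) fun x => by
        refine (hp₁ x).symm.trans ((hσ x).symm.trans ?_)
        change σ (l x) = σ (i (1 ⊗ₜ algebraMap _ C x))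
        rw [hi, hlC, map_one, one_mul]
    exact ⟨σ, fun b => by rw [this]; rfl⟩
  have h2 : ∀ σ : Gal(AlgebraicClosure K/K), (∀ b, σ (i b) = i b) → σ • m = m := by
    intro σ hσ
    refine hm σ fun x => ?_
    have h : ∀ x : 𝓞 L, σ (l x) = l x := fun x => by
      have := hσ (1 ⊗ₜ algebraMap _ C x)
      rwa [hi, hlC, map_one, one_mul] at this
    obtain ⟨x, y, hy, rfl⟩ := IsFractionRing.div_surjective (A := 𝓞 L) x
    have hx := h x
    have hy := h y
    rw [map_div₀, map_div₀]
    exact congrArg₂ _ hx hy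
  obtain ⟨V, s, z, hz, hval⟩ := exists_section_of_orbit (R := S.integer K) (K := K) i m h1 h2
  refine ⟨V, s, z, hz, fun φ O hR hL hq => ?_⟩
  -- The image of `i` is generated by `S`-integers, `l (𝓞 L)` and `(l a)⁻¹`, all in `O` because `a ∉
  -- q`.
  have hiO : ∀ b, i b ∈ O := by
    intro b
    induction b with
    | zero => rw [map_zero]; exact O.zero_mem
    | add b b' hb hb' => rw [map_add]; exact O.add_mem hb hb'
    | tmul r c =>
      rw [hi]
      refine O.mul_mem (hR r) ?_
      obtain ⟨⟨x, ⟨_, n, rfl⟩⟩, hx⟩ := IsLocalization.surj (Submonoid.powers a) c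
      have h := congrArg lC hx
      rw [map_mul, hlC, hlC] at h
      have h' : lC c = l x * (l a)⁻¹ ^ n := by
        rw [← h]
        simp only [map_pow]
        rw [mul_assoc, ← mul_pow, mul_inv_cancel₀ ha, one_pow, mul_one]
      rw [h']
      exact O.mul_mem (hL x) (O.pow_mem (hq a haq) n)
  obtain ⟨b, hb⟩ := hval φ
  refine hb ▸ ⟨hiO _, ?_⟩
  have : (i b)⁻¹ = i (b⁻¹ : _ˣ) := by
    refine inv_eq_of_mul_eq_one_right ?_
    rw [← map_mul, Units.mul_inv, map_one]
  exact this ▸ hiO _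

end Localization

/-! ### Unramifiedness from a valuation with unchanged value group -/

section Unramified

variable {K : Type u} [Field K] [NumberField K] {L : Type u} [Field L]

lemma valuation_integers_le_one {Γ : Type*} [LinearOrderedCommGroupWithZero Γ]
    (w : Valuation L Γ) (x : 𝓞 L) : w x ≤ 1 :=
  (Valuation.integer.integers w).mem_of_integral
    ((NumberField.RingOfIntegers.isIntegral_coe x).tower_top (A := w.integer))

variable [NumberField L] [Algebra K L]

/-- If a valuation of `L` extends the valuation `v` of `K` with the same value group, its centre
is unramified over `K`. -/
lemma exists_isUnramifiedAt_of_valuation (v : HeightOneSpectrum (𝓞 K))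
    (w : Valuation L (WithZero (Multiplicative ℤ)))
    (hw : ∀ x : K, w (algebraMap K L x) = v.valuation K x) :
    ∃ (q : Ideal (𝓞 L)) (_ : q.IsPrime), Algebra.IsUnramifiedAt (𝓞 K) q ∧
      ∀ x : 𝓞 L, x ∉ q → w x = 1 := by
  have hle := valuation_integers_le_one w
  have hmul : ∀ a b : 𝓞 L, w ((a * b : 𝓞 L) : L) = w a * w b := fun a b => map_mul w (a : L) b
  let q : Ideal (𝓞 L) :=
    { carrier := {x | w x < 1}
      add_mem' := fun {a b} ha hb => w.map_add_lt (x := (a : L)) (y := b) ha hb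
      zero_mem' := by simp
      smul_mem' := fun c x hx => (hmul c x).trans_lt 
        ((mul_le_of_le_one_left zero_le (hle c)).trans_lt hx) }
  have hq : ∀ x, x ∈ q ↔ w x < 1 := fun x => Iff.rfl
  have hprime : q.IsPrime := by
    refine ⟨fun h => ?_, fun {a b} hab => ?_⟩
    · have := (hq 1).1 (h ▸ Submodule.mem_top)
      simp at this
    · by_contra! h
      rw [hq, hq, not_lt, not_lt] at h
      rw [hq, hmul] at hab
      exact hab.not_ge (one_le_mul h.1 h.2)
  have hv : ∀ x : 𝓞 K, w (algebraMap (𝓞 K) (𝓞 L) x : 𝓞 L) = v.intValuation x := fun x => by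
    rw [← v.valuation_of_algebraMap (K := K), ← hw]
    rfl
  have hmem : ∀ x : 𝓞 K, algebraMap (𝓞 K) (𝓞 L) x ∈ q ↔ x ∈ v.asIdeal := fun x => by
    rw [hq, hv, v.intValuation_lt_one_iff_mem]
  have hover : q.LiesOver v.asIdeal := ⟨by ext x; exact (hmem x).symm⟩
  -- The values of `w` are discrete: `w c < 1` forces `w c ≤ exp (-1)`.
  have hsq : ∀ x ∈ q ^ 2, w x ≤ WithZero.exp (-2) := by
    intro x hx
    rw [pow_two] at hx
    induction hx using Submodule.mul_induction_on' with
    | mem_mul_mem a ha b hb =>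
      have h : ∀ c ∈ q, w c ≤ WithZero.exp (-1) := fun c hc => by
        have := (hq c).1 hc
        rcases eq_or_ne (w c) 0 with h0 | h0
        · rw [h0]; exact zero_le
        · rw [← WithZero.exp_log h0] at this ⊢
          rw [← WithZero.exp_zero, WithZero.exp_lt_exp] at this
          rw [WithZero.exp_le_exp]
          omega
      rw [hmul]
      exact mul_le_mul' (h a ha) (h b hb)
    | add a _ b _ ha hb => exact w.map_add_le (x := (a : L)) (y := b) ha hb
  refine ⟨q, hprime, ?_, fun x hx => le_antisymm (hle x) (not_lt.1 fun h => hx h)⟩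
  -- Ramification would put the extension of `v.asIdeal` inside `q ^ 2`, but a uniformizer of `v`
  -- has `w`-value `exp (-1)`.
  rw [← Ideal.ramificationIdx_eq_one_iff, ← Ideal.ramificationIdx'_eq_ramificationIdx v.asIdeal q
    v.ne_bot, ← not_ne_iff, Ideal.ramificationIdx'_ne_one_iff]
  · intro h
    obtain ⟨π, hπ⟩ := v.intValuation_exists_uniformizer
    have h1 := hsq _ (h (Ideal.mem_map_of_mem _ ((v.intValuation_lt_one_iff_mem π).1 (by
      rw [hπ, ← WithZero.exp_zero, WithZero.exp_lt_exp]
      norm_num))))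
    rw [hv, hπ, WithZero.exp_le_exp] at h1
    norm_num at h1
  · exact Ideal.map_le_iff_le_comap.2 fun x hx => (hmem x).2 hx

end Unramified

/-! ### Fields of definition of characters -/

section DefinitionField

variable {K A : Type u} [Field K] [CommRing A] [HopfAlgebra K A]

/-- A field of definition of a character `χ`: a finite extension `L` of `K` whose absolute Galois
group is the stabilizer of `χ`. -/
lemma Characters.exists_field_of_definition [PerfectField K]
    (χ : Characters K A (AlgebraicClosure K)) :
    ∃ (L : IntermediateField K (AlgebraicClosure K)), FiniteDimensional K L ∧
      ∀ σ : Gal(AlgebraicClosure K/K), (∀ x : L, σ x = x) ↔ σ • χ = χ := by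
  let H := MulAction.stabilizer Gal(AlgebraicClosure K/K) χ
  have hH : IsOpen (H : Set Gal(AlgebraicClosure K/K)) := χ.isOpen_stabilizer
  -- An open subgroup is closed, so the infinite Galois correspondence recovers it from its fixed
  -- field.
  have h : (IntermediateField.fixedField H).fixingSubgroup = H :=
    InfiniteGalois.fixingSubgroup_fixedField
      (⟨H, H.isClosed_of_isOpen hH⟩ : ClosedSubgroup Gal(AlgebraicClosure K/K))
  refine ⟨IntermediateField.fixedField H, ?_, fun σ => ?_⟩
  · refine (InfiniteGalois.isOpen_iff_finite _).1 ?_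
    exact h.symm ▸ hH
  · exact (SetLike.ext_iff.1 h σ)

/-- If a character `χ` becomes defined over an extension `k` of `K` via an embedding of `K̄` into
`Ω`, then so does its field of definition. -/
lemma Characters.exists_ringHom_of_map_eq {k Ω : Type u} [Field k] [Algebra K k] [Field Ω]
    [Algebra K Ω] [Algebra k Ω] [IsScalarTower K k Ω] [IsGalois k Ω]
    (ι : AlgebraicClosure K →ₐ[K] Ω) {χ : Characters K A (AlgebraicClosure K)}
    {ψ : Characters K A k} (h : χ.map ι = ψ.map (IsScalarTower.toAlgHom K k Ω))
    (L : IntermediateField K (AlgebraicClosure K))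
    (hL : ∀ σ : Gal(AlgebraicClosure K/K), σ • χ = χ → ∀ x : L, σ x = x) :
    ∃ j : L →ₐ[K] k, ∀ x, algebraMap k Ω (j x) = ι x := by
  have hfix : ∀ x : L, ι x ∈ (IsScalarTower.toAlgHom K k Ω).range := by
    intro x
    refine (InfiniteGalois.mem_range_algebraMap_iff_fixed (k := k) _).2 fun τ => ?_
    let := ι.toRingHom.toAlgebra
    have : IsScalarTower K (AlgebraicClosure K) Ω := .of_algebraMap_eq fun x => (ι.commutes x).symm
    -- The restriction of `τ` to `K̄` along `ι` fixes `χ`, since `χ.map ι` is defined over `k`.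
    -- Hence `τ` fixes `ι(L)` pointwise.
    let τ' := (τ.restrictScalars K).restrictNormal (AlgebraicClosure K)
    have hτ : ∀ y, ι (τ' y) = τ (ι y) :=
      (τ.restrictScalars K).restrictNormal_commutes (AlgebraicClosure K)
    rw [← hτ, hL τ' _ x]
    apply Characters.map_injective ι
    have h1 : ι.comp (τ' : AlgebraicClosure K →ₐ[K] AlgebraicClosure K) =
        (τ.restrictScalars K : Ω →ₐ[K] Ω).comp ι := AlgHom.ext hτ
    have h2 : (τ.restrictScalars K : Ω →ₐ[K] Ω).comp (IsScalarTower.toAlgHom K k Ω) =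
        IsScalarTower.toAlgHom K k Ω := AlgHom.ext τ.commutes
    rw [Characters.smul_eq_map, Characters.map_map, h1, ← Characters.map_map, h,
      Characters.map_map, h2]
  let e := AlgEquiv.ofInjective (IsScalarTower.toAlgHom K k Ω) (algebraMap k Ω).injective
  refine ⟨(e.symm : _ →ₐ[K] k).comp ((ι.comp L.val).codRestrict _ hfix), fun x => ?_⟩
  exact congrArg Subtype.val (e.apply_symm_apply ⟨ι x, hfix x⟩)

end DefinitionField

/-! ### The isomorphism for tori over number fields -/

section NumberField

variable {K A : Type u} [Field K] [NumberField K] [CommRing A] [HopfAlgebra K A]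
  (S : Set (HeightOneSpectrum (𝓞 K)))

/-- The generic point of `𝓞 L` is unramified over `𝓞 K`, so a character with field of definition `L`
spreads out to a section. This identifies the generic stalk of `j_* T̂` with all of `T̂`. -/
lemma exists_section_eq (m : CharacterModule K A) :
    ∃ (V : (Spec (.of (S.integer K))).Etale)
      (s : Sections (S.integer K) K (CharacterModule K A) V)
      (z : GeomPoints K ((etalePullback (genericPt (S.integer K) K)).obj V)), s.1 z = m := by
  obtain ⟨L, _, hL⟩ := Characters.exists_field_of_definition m.toMul
  have : NumberField L := .of_module_finite K L
  have : Algebra.IsUnramifiedAt (𝓞 K) (⊥ : Ideal (𝓞 L)) := Algebra.isUnramifiedAt_bot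
  obtain ⟨V, s, z, hz, -⟩ := exists_section_of_isUnramifiedAt S L.val m
    (fun σ hσ => congrArg Additive.ofMul ((hL σ).1 hσ)) ⊥
  exact ⟨V, s, z, hz⟩

/-- A point whose character values are the values of a homomorphism `j_* T̂ → 𝔾ₘ` is an
`S`-unit. -/
lemma mem_sUnits_of_value_eq (hA : IsTorus K A) (x : Points K A K)
    (φ : PushforwardHom (S.integer K) K (CharacterModule K A))
    (hφ : ∀ (V : (Spec (.of (S.integer K))).Etale)
      (s : Sections (S.integer K) K (CharacterModule K A) V) z, φ.value s z =
        (s.1 z).toMul.eval (Points.map (Algebra.ofId K (AlgebraicClosure K)) x)) :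
    x ∈ sUnits K A S := by
  simp only [sUnits, Subgroup.mem_iInf]
  intro v hv ψ
  let Ω := AlgebraicClosure (v.adicCompletion K)
  let ι : AlgebraicClosure K →ₐ[K] Ω := IsAlgClosed.lift
  obtain ⟨χ, hχ⟩ := Characters.map_surjective hA ι
    (ψ.map (IsScalarTower.toAlgHom K (v.adicCompletion K) Ω))
  obtain ⟨L, _, hL⟩ := Characters.exists_field_of_definition χ
  have : NumberField L := .of_module_finite K L
  obtain ⟨j, hj⟩ := Characters.exists_ringHom_of_map_eq ι hχ L fun σ => (hL σ).2
  -- `L` embeds in `K_v`, so the valuation pulled back from `K_v` extends `v` without enlarging the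
  -- value group.
  let w : Valuation L (WithZero (Multiplicative ℤ)) :=
    (Valued.v (R := v.adicCompletion K)).comap j.toRingHom
  obtain ⟨q, _, _, hq⟩ := exists_isUnramifiedAt_of_valuation v w fun y => by
    rw [← v.valuedAdicCompletion_eq_valuation']
    exact congrArg Valued.v (j.commutes y)
  obtain ⟨V, s, z, hz, h⟩ := exists_section_of_isUnramifiedAt S L.val
    (Additive.ofMul χ : CharacterModule K A)
    (fun σ hσ => congrArg Additive.ofMul ((hL σ).1 hσ)) q
  -- `O` consists of the elements of `K̄` that `ι` sends into the valuation ring of `K_v`. It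
  -- contains the `S`-integers because `v ∉ S`.
  let O : Subring (AlgebraicClosure K) := ((v.adicCompletionIntegers K).toSubring.map
    (algebraMap (v.adicCompletion K) Ω)).comap ι.toRingHom
  have hO : ∀ {y : AlgebraicClosure K} {c : v.adicCompletion K},
      algebraMap (v.adicCompletion K) Ω c = ι y → (y ∈ O ↔ Valued.v c ≤ 1) := by
    intro y c hc
    constructor
    · rintro ⟨d, hd, hdy⟩
      obtain rfl : d = c := (algebraMap _ Ω).injective (hdy.trans hc.symm)
      exact hd
    · exact fun h => ⟨c, h, hc⟩
  obtain ⟨h1, h2⟩ := h φ O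
    (fun r => (hO (c := algebraMap K _ r) (ι.commutes (r : K)).symm).2
      ((v.valuedAdicCompletion_eq_valuation' (r : K)).trans_le (r.2 v hv)))
    (fun y => (hO (hj y)).2 (valuation_integers_le_one w y))
    (fun y hy => (hO (c := (j y)⁻¹) (by rw [map_inv₀, hj, map_inv₀]; rfl)).2 (by
      rw [map_inv₀]
      exact (inv_eq_one.2 (hq y hy)).le))
  have hval : algebraMap (v.adicCompletion K) Ω
      (ψ.eval (Points.map (Algebra.ofId K (v.adicCompletion K)) x)) = ι (φ.value s z) := by
    rw [hφ, hz, ← Characters.eval_map_ofId]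
    exact ((congrArg (fun ξ => ξ.eval (Points.map (Algebra.ofId K Ω) x)) hχ).trans
      (Characters.eval_map_ofId _ ψ x)).symm
  refine le_antisymm ((hO hval).1 h1) ?_
  have h3 := (hO (c := (ψ.eval (Points.map (Algebra.ofId K (v.adicCompletion K)) x))⁻¹)
    (by rw [map_inv₀, hval, map_inv₀])).1 h2
  rw [map_inv₀] at h3
  have h0 : ψ.eval (Points.map (Algebra.ofId K (v.adicCompletion K)) x) ≠ 0 := by
    intro h0
    rw [h0, map_zero] at hval
    exact φ.value_ne_zero s z ((map_eq_zero ι).1 hval.symm)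
  exact (inv_le_one₀ (zero_lt_iff.2 ((Valuation.ne_zero_iff _).2 h0))).1 h3

/-- The homomorphism `j_* T̂ → 𝔾ₘ` attached to an `S`-unit, determined by its values. -/
lemma exists_pushforwardHom_of_mem_sUnits {x : Points K A K} (hx : x ∈ sUnits K A S) :
    ∃ φ : PushforwardHom (S.integer K) K (CharacterModule K A),
      ∀ (V : (Spec (.of (S.integer K))).Etale)
        (s : Sections (S.integer K) K (CharacterModule K A) V) z, φ.value s z =
          (s.1 z).toMul.eval (Points.map (Algebra.ofId K (AlgebraicClosure K)) x) :=
  exists_pushforwardHom (M := CharacterModule K A)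
    ((Characters.evalHom (Points.map (Algebra.ofId K (AlgebraicClosure K)) x)).comp
      (MulEquiv.toMonoidHom (MulEquiv.refl _) : Multiplicative (CharacterModule K A) →*
        Characters K A (AlgebraicClosure K)))
    (fun σ m => Characters.eval_smul_ofId σ m.toMul x)
    (fun m => isIntegral_eval_of_mem_sUnits hx m.toAdd.toMul)

/-- Every homomorphism `j_* T̂ → 𝔾ₘ` is given by an `S`-unit. -/
lemma exists_mem_sUnits_of_pushforwardHom (hA : IsTorus K A)
    (φ : PushforwardHom (S.integer K) K (CharacterModule K A)) :
    ∃ x ∈ sUnits K A S, ∀ (V : (Spec (.of (S.integer K))).Etale)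
        (s : Sections (S.integer K) K (CharacterModule K A) V) z, φ.value s z =
          (s.1 z).toMul.eval (Points.map (Algebra.ofId K (AlgebraicClosure K)) x) := by
  obtain ⟨f, hf, hfφ⟩ := PushforwardHom.exists_stalk (exists_section_eq S) φ
  obtain ⟨x, hx⟩ := Points.exists_eval_eq hA
    (f.comp (MulEquiv.toMonoidHom (MulEquiv.refl _) :
      Characters K A (AlgebraicClosure K) →* Multiplicative (CharacterModule K A)))
    (fun σ χ => hf σ (Additive.ofMul χ))
  have h : ∀ (V : (Spec (.of (S.integer K))).Etale)
        (s : Sections (S.integer K) K (CharacterModule K A) V) z, φ.value s z =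
          (s.1 z).toMul.eval (Points.map (Algebra.ofId K (AlgebraicClosure K)) x) :=
    fun V s z => (hfφ V s z).trans (hx (s.1 z).toMul).symm
  exact ⟨x, mem_sUnits_of_value_eq S hA x φ h, h⟩

/-- The isomorphism between the group of `S`-units of a torus and `Hom(j_* T̂, 𝔾ₘ)`. -/
theorem exists_addEquiv_sUnits (hA : IsTorus K A) :
    ∃ e : Additive (sUnits K A S) ≃+ PushforwardHom (S.integer K) K (CharacterModule K A),
      ∀ (x : sUnits K A S) (V : (Spec (.of (S.integer K))).Etale)
        (s : Sections (S.integer K) K (CharacterModule K A) V) z,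
        (e (Additive.ofMul x)).value s z =
          (s.1 z).toMul.eval (Points.map (Algebra.ofId K (AlgebraicClosure K)) x.1) := by
  choose g hg using fun x : sUnits K A S => exists_pushforwardHom_of_mem_sUnits S x.2
  let G : Additive (sUnits K A S) →+ PushforwardHom (S.integer K) K (CharacterModule K A) :=
    AddMonoidHom.mk' (fun x => g x.toMul) fun x y => PushforwardHom.ext_value fun V s z => by
      rw [PushforwardHom.add_value, hg, hg, hg, toMul_add, Subgroup.coe_mul, map_mul,
        Characters.eval_mul]
  refine ⟨AddEquiv.ofBijective G ⟨fun x y hxy => ?_, fun φ => ?_⟩, fun x => hg x⟩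
  -- Every character is the value of some section, and characters separate the points of a torus.
  · refine Additive.toMul.injective (Subtype.ext (Points.eq_of_eval_eq hA _ _ fun χ => ?_))
    obtain ⟨V, s, z, hz⟩ := exists_section_eq S (Additive.ofMul χ)
    have h := congrArg (fun φ => PushforwardHom.value φ s z) hxy
    change (g x.toMul).value s z = (g y.toMul).value s z at h
    rwa [hg, hg, hz] at h
  · obtain ⟨x, hx, h⟩ := exists_mem_sUnits_of_pushforwardHom S hA φ
    exact ⟨Additive.ofMul ⟨x, hx⟩, PushforwardHom.ext_value fun V s z =>
      (hg ⟨x, hx⟩ V s z).trans (h V s z).symm⟩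

end NumberField

end EtaleTori

end

open EtaleTori
theorem mainTheorem7 {K : Type u} [Field K] [NumberField K]
    (S : Set (HeightOneSpectrum (𝓞 K))) (hS : S.Finite)
    {A : Type u} [CommRing A] [HopfAlgebra K A] (hA : IsTorus K A) :
    ∃ e : Additive (sUnits K A S) ≃+
        ((etalePushforward (genericInclusion K S)).obj (characterSheaf K A) ⟶
          multiplicativeSheaf (specSIntegers K S)),
      ∀ (x : sUnits K A S) (V : (specSIntegers K S).Etale)
        (s : equivariantMaps K (CharacterModule K A)
          ((etalePullback (genericInclusion K S)).obj V))
        (p : GeomPoints K ((etalePullback (genericInclusion K S)).obj V)),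
        unitValue (p.1 ≫ etalePullbackFst (genericInclusion K S) V)
            ((e (Additive.ofMul x)).hom.app (op V) s) =
          (Additive.toMul (s.1 p)).eval
            (Points.map (Algebra.ofId K (AlgebraicClosure K)) x.1) :=
  exists_addEquiv_sUnits S hA
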